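/- Let $\mathbb K$ be an algebraically closed field of characteristic $0$, let $d\ge 0$ and $N\ge 1$, and let $A\subseteq M=\mathbb Z^{d}$ be a finite set whose affine span is $M_{\mathbb R}=\mathbb R^{d}$. Put $P=\operatorname{conv}(A)$. For $D\subseteq\mathbb R^d$ let $K(D)\subseteq\mathbb R\times\mathbb R^{d}$ be the convex cone generated by $\{1\}\times D$; write $\chi$ also for $(1,\chi)$. All vectors in $\mathbb R^N$, $\mathbb Q^N$ are compared lexicographically, the top entry being the most significant one. *Subdivisions and GKZ-cones.* A polytopal subdivision $\mathcal Q$ of $(P,A)$ is a finite set of marked polytopes $(Q,A_Q)$ with $A_Q\subseteq A$, $Q=\operatorname{conv}(A_Q)$ and $\dim Q=d$, which cover $P$, such that for any two members the intersection $Q\cap Q'$ is empty or a face of both, and $A_Q\cap Q\cap Q'=A_{Q'}\cap Q\cap Q'$. Let $A_{\mathcal Q}=\bigcup_Q A_Q$. For a real $N\times A$ matrix $\Psi$ with columns $\Psi(\chi)$, $\chi\in A$, write $\Psi\in\overline{C(\mathcal Q,N)}$ if there is a continuous map $g:K(P)\to\mathbb R^N$, linear on each $K(Q)$, with $g(tu+(1-t)v)\ge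 t g(u)+(1-t)g(v)$ for $u,v\in K(P)$, $t\in[0,1]$, with $g(\chi)=\Psi(\chi)$ for $\chi\in A_{\mathcal Q}$ and $g(\chi)\ge\Psi(\chi)$ for $\chi\in A\setminus A_{\mathcal Q}$; such a $g$ is unique and is denoted $g_\Psi$. A domain of linearity of $g_\Psi$ is a maximal set $D$ among the closures of non-empty connected relatively open subsets of $P$ for which $g_\Psi$ is linear on $K(D)$; it is marked by $\{\chi\in A\cap D: g_\Psi(\chi)=\Psi(\chi)\}$. The open GKZ-cone $C(\mathcal Q,N)$ is the set of all $\Psi\in\overline{C(\mathcal Q,N)}$ such that the marked domains of linearity of $g_\Psi$ are exactly the members $(Q,A_Q)$ of $\mathcal Q$. *The toric variety and the quasi-valuation.* Let $T=(\mathbb K^*)^{d}$, let $\hat X_A\subseteq\mathbb K^A$ be the Zariski closure of $\{(c\,\chi(t))_{\chi\in A}: c\in\mathbb K^*,\,t\in T\}$, i.e. the affine cone over the embedded toric variety $X_A\subseteq\mathbb P(\mathbb K^A)$, and let $\mathbb K[\hat X_A]$ be its coordinate ring, graded by the degree of polynomials, so that $X_A=\operatorname{Proj}\mathbb K[\hat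 X_A]$. Let $S\subseteq\mathbb Z\times M$ be the monoid generated by the $(1,\chi)$, $\chi\in A$. The ring $\mathbb K[\hat X_A]$ has the basis $\{f_u: u\in S\}$, where $f_u$ is the class of any monomial $x^\alpha$ with $\sum_\chi\alpha_\chi(1,\chi)=u$, of degree the first coordinate of $u$. For $Q\in\mathcal Q$ let $S_Q=S\cap K(Q)$, and grade $\mathbb K[S_Q]$ by the first coordinate. For $\Psi\in C(\mathcal Q,N)$ with rational entries and $Q\in\mathcal Q$ let $\psi_Q:\mathbb Q\times M_{\mathbb Q}\to\mathbb Q^N$ be the linear map with $\psi_Q(\chi)=\Psi(\chi)$ for $\chi\in A_Q$, and define the quasi-valuation $\mathcal V_\Psi:\mathbb K[\hat X_A]\to\mathbb Q^N\cup\{\infty\}$ by $\mathcal V_\Psi(0)=\infty$ and $$\mathcal V_\Psi\Big(\sum_u a_uf_u\Big)=\min\{\psi_Q(u): Q\in\mathcal Q,\ a_u\ne0\}=\min\{g_\Psi(u): a_u\neq 0\}.$$ Let $\operatorname{gr}_{\mathcal V_\Psi}\mathbb K[\hat X_A]=\bigoplus_{\mathbf a\in\mathbb Q^N}\{\mathcal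 V_\Psi\ge\mathbf a\}/\{\mathcal V_\Psi>\mathbf a\}$ be the associated graded algebra, with the $\mathbb N$-grading inherited from the degree on $\mathbb K[\hat X_A]$, and let $\bar f_u$ be the class of $f_u$ in degree $\mathbf a=\mathcal V_\Psi(f_u)$. **Theorem.** Let $\mathcal Q$ be a polytopal subdivision of $(P,A)$ and let $\Psi\in C(\mathcal Q,N)$ have rational entries. 1. The $\mathbb K$-algebra $\operatorname{gr}_{\mathcal V_\Psi}\mathbb K[\hat X_A]$ is finitely generated and reduced, and $X_0=\operatorname{Proj}(\operatorname{gr}_{\mathcal V_\Psi}\mathbb K[\hat X_A])$ is reduced. 2. For each $Q\in\mathcal Q$ the monoid $S_Q$ is finitely generated, and the toric variety $X_Q=\operatorname{Proj}\mathbb K[S_Q]$ (the $\operatorname{Proj}$ of the semigroup algebra of $S_Q$) is an integral scheme with $\dim X_Q=\dim X_A$. 3. $X_0$ is the irredundant union of the $X_Q$, $Q\in\mathcal Q$: there are closed immersions $\iota_Q:X_Q\to X_0$ over $\mathbb K$ whose images cover $X_0$, and no image is contained in the union of the others. 4. $X_0$ is equidimensional of dimension $\dim X_A$: every irreducible component of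 $X_0$ has dimension $\dim X_A$. 5. $X_0$ depends only on $\mathcal Q$: if $\Psi'\in C(\mathcal Q,N)$ is another matrix with rational entries, then there is an isomorphism of $\mathbb K$-algebras $\operatorname{gr}_{\mathcal V_\Psi}\mathbb K[\hat X_A]\cong\operatorname{gr}_{\mathcal V_{\Psi'}}\mathbb K[\hat X_A]$ that preserves the $\mathbb N$-grading and sends $\bar f_u$ to $\bar f_u$ for all $u\in S$, and $\operatorname{Proj}(\operatorname{gr}_{\mathcal V_\Psi}\mathbb K[\hat X_A])\cong\operatorname{Proj}(\operatorname{gr}_{\mathcal V_{\Psi'}}\mathbb K[\hat X_A])$ over $\mathbb K$. -/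

import Mathlib

open scoped DirectSum

namespace GKZ

set_option linter.unusedSectionVars false

universe u

/-! ### Graded pieces cut out by projections -/

section Projections

variable {K M : Type*} [Field K] [AddCommGroup M] [Module K M] {𝒜 : ℕ → Submodule K M}
  {p : ℕ → M →ₗ[K] M}

theorem proj_coe_apply (same : ∀ i, ∀ x ∈ 𝒜 i, p i x = x)
    (ne : ∀ i j, j ≠ i → ∀ x ∈ 𝒜 j, p i x = 0) (i : ℕ) (y : ⨁ i, 𝒜 i) :
    p i (DirectSum.coeAddMonoidHom 𝒜 y) = (y i : M) := by
  induction y using DirectSum.induction_on with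
  | zero => simp
  | add y z hy hz => simp [map_add, hy, hz]
  | of j y =>
    rw [DirectSum.coeAddMonoidHom_of]
    rcases eq_or_ne j i with rfl | hij
    · rw [same _ _ y.2, DirectSum.of_eq_same]
    · rw [ne _ _ hij _ y.2, DirectSum.of_eq_of_ne _ _ _ hij.symm]; rfl

theorem isInternal_of_proj (same : ∀ i, ∀ x ∈ 𝒜 i, p i x = x)
    (ne : ∀ i j, j ≠ i → ∀ x ∈ 𝒜 j, p i x = 0) (sup : (⨆ i, 𝒜 i) = ⊤) :
    DirectSum.IsInternal 𝒜 := by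
  classical
  constructor
  · rw [injective_iff_map_eq_zero]
    intro x hx
    ext i : 2
    have h := proj_coe_apply same ne i x
    rw [hx, map_zero] at h
    simpa using h.symm
  · intro x
    have hx : x ∈ ⨆ i, 𝒜 i := by rw [sup]; trivial
    rw [Submodule.iSup_eq_range_dfinsupp_lsum] at hx
    obtain ⟨y, hy⟩ := hx
    exact ⟨y, hy⟩

end Projections

/-! ### Quasi-valuations and their associated graded algebras -/

/-- A quasi-valuation on the `K`-algebra `R` with values in the ordered group `Γ`, extended by
`∞ = ⊤`. The last field makes the associated graded algebra unital. -/
structure QuasiValuation (K R Γ : Type*) [Field K] [CommRing R] [Algebra K R]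
    [AddCommGroup Γ] [LinearOrder Γ] where
  toFun : R → WithTop Γ
  eq_top_iff' : ∀ x, toFun x = ⊤ ↔ x = 0
  min_le_add' : ∀ x y, min (toFun x) (toFun y) ≤ toFun (x + y)
  smul' : ∀ (c : K) (x : R), c ≠ 0 → toFun (c • x) = toFun x
  add_le_mul' : ∀ x y, toFun x + toFun y ≤ toFun (x * y)
  map_one' : toFun 1 = 0

namespace QuasiValuation

variable {K R Γ : Type*} [Field K] [CommRing R] [Algebra K R]
  [AddCommGroup Γ] [LinearOrder Γ] (ν : QuasiValuation K R Γ)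

theorem le_smul (c : K) (x : R) : ν.toFun x ≤ ν.toFun (c • x) := by
  rcases eq_or_ne c 0 with rfl | hc
  · rw [zero_smul, (ν.eq_top_iff' 0).2 rfl]; exact le_top
  · exact (ν.smul' c x hc).ge

/-- `F_{≥ a}`. -/
def filtGE (a : Γ) : Submodule K R where
  carrier := {f | (a : WithTop Γ) ≤ ν.toFun f}
  zero_mem' := by simp [(ν.eq_top_iff' 0).2 rfl]
  add_mem' {f g} hf hg := (le_min hf hg).trans (ν.min_le_add' f g)
  smul_mem' c f hf := le_trans hf (ν.le_smul c f)

/-- `F_{> a}`. -/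
def filtGT (a : Γ) : Submodule K R where
  carrier := {f | (a : WithTop Γ) < ν.toFun f}
  zero_mem' := by simp [(ν.eq_top_iff' 0).2 rfl]
  add_mem' {f g} hf hg := lt_of_lt_of_le (lt_min hf hg) (ν.min_le_add' f g)
  smul_mem' c f hf := lt_of_lt_of_le hf (ν.le_smul c f)

/-- The leaf `F_{≥ a} / F_{> a}`. -/
def Leaf (a : Γ) : Type _ := ν.filtGE a ⧸ (ν.filtGT a).comap (ν.filtGE a).subtype

instance (a : Γ) : AddCommGroup (ν.Leaf a) :=
  inferInstanceAs (AddCommGroup (ν.filtGE a ⧸ (ν.filtGT a).comap (ν.filtGE a).subtype))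

instance (a : Γ) : Module K (ν.Leaf a) :=
  inferInstanceAs (Module K (ν.filtGE a ⧸ (ν.filtGT a).comap (ν.filtGE a).subtype))

variable [IsOrderedAddMonoid Γ]

theorem mul_mem_filtGE {a b : Γ} {f g : R} (hf : f ∈ ν.filtGE a) (hg : g ∈ ν.filtGE b) :
    f * g ∈ ν.filtGE (a + b) := by
  refine le_trans ?_ (ν.add_le_mul' f g)
  rw [WithTop.coe_add]
  exact add_le_add hf hg

theorem mul_mem_filtGT_left {a b : Γ} {f g : R} (hf : f ∈ ν.filtGT a) (hg : g ∈ ν.filtGE b) :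
    f * g ∈ ν.filtGT (a + b) := by
  refine lt_of_lt_of_le ?_ (ν.add_le_mul' f g)
  rw [WithTop.coe_add]
  exact WithTop.add_lt_add_of_lt_of_le WithTop.coe_ne_top hf hg

theorem mul_mem_filtGT_right {a b : Γ} {f g : R} (hf : f ∈ ν.filtGE a) (hg : g ∈ ν.filtGT b) :
    f * g ∈ ν.filtGT (a + b) := by
  rw [mul_comm, add_comm]
  exact ν.mul_mem_filtGT_left hg hf

theorem algebraMap_mem_filtGE (c : K) : algebraMap K R c ∈ ν.filtGE 0 := by
  rw [Algebra.algebraMap_eq_smul_one]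
  refine Submodule.smul_mem _ _ ?_
  change ((0 : Γ) : WithTop Γ) ≤ ν.toFun 1
  rw [ν.map_one', WithTop.coe_zero]

/-- The class of `f ∈ F_{≥ a}` in the leaf `F_{≥ a} / F_{> a}`. -/
def leafMk (a : Γ) : ν.filtGE a →ₗ[K] ν.Leaf a := Submodule.mkQ _

theorem leafMk_surjective (a : Γ) : Function.Surjective (ν.leafMk a) := Submodule.mkQ_surjective _

theorem leafMk_eq_zero {a : Γ} (f : ν.filtGE a) (hf : f.1 ∈ ν.filtGT a) : ν.leafMk a f = 0 :=
  (Submodule.Quotient.mk_eq_zero _).2 hf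

/-- Auxiliary bilinear map `(f, g) ↦ [f * g]`. -/
def mulAux (a b : Γ) : ν.filtGE a →ₗ[K] ν.filtGE b →ₗ[K] ν.Leaf (a + b) :=
  LinearMap.mk₂ K
    (fun f g => ν.leafMk (a + b) ⟨f.1 * g.1, ν.mul_mem_filtGE f.2 g.2⟩)
    (fun f f' g => by rw [← map_add]; congr 1; ext; simp [add_mul])
    (fun c f g => by rw [← map_smul]; congr 1; ext; simp)
    (fun f g g' => by rw [← map_add]; congr 1; ext; simp [mul_add])
    (fun c f g => by rw [← map_smul]; congr 1; ext; simp)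

/-- The multiplication of leaves, `[f] * [g] = [f * g]`. -/
def leafMul (a b : Γ) : ν.Leaf a →ₗ[K] ν.Leaf b →ₗ[K] ν.Leaf (a + b) :=
  Submodule.liftQ _
    (Submodule.liftQ _ (ν.mulAux a b).flip (fun g hg => by
      ext f
      exact ν.leafMk_eq_zero _ (ν.mul_mem_filtGT_right f.2 hg))).flip
    (fun f hf => by
      refine LinearMap.ext fun g => ?_
      obtain ⟨g, rfl⟩ := ν.leafMk_surjective b g
      exact ν.leafMk_eq_zero _ (ν.mul_mem_filtGT_left hf g.2))

theorem leafMul_mk {a b : Γ} (f : ν.filtGE a) (g : ν.filtGE b) :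
    ν.leafMul a b (ν.leafMk a f) (ν.leafMk b g) =
      ν.leafMk (a + b) ⟨f.1 * g.1, ν.mul_mem_filtGE f.2 g.2⟩ := rfl

theorem gmk_eq {a b : Γ} (hab : a = b) (f : ν.filtGE a) (g : ν.filtGE b) (hfg : f.1 = g.1) :
    (GradedMonoid.mk a (ν.leafMk a f) : GradedMonoid ν.Leaf) = GradedMonoid.mk b (ν.leafMk b g) := by
  subst hab
  obtain rfl : f = g := Subtype.ext hfg
  rfl

instance : GradedMonoid.GMul ν.Leaf where
  mul {a b} x y := ν.leafMul a b x y

instance : GradedMonoid.GOne ν.Leaf where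
  one := ν.leafMk 0 ⟨1, by simpa using ν.algebraMap_mem_filtGE 1⟩

theorem gmk_mul {a b : Γ} (f : ν.filtGE a) (g : ν.filtGE b) :
    (GradedMonoid.mk a (ν.leafMk a f) * GradedMonoid.mk b (ν.leafMk b g) : GradedMonoid ν.Leaf) =
      GradedMonoid.mk (a + b) (ν.leafMk (a + b) ⟨f.1 * g.1, ν.mul_mem_filtGE f.2 g.2⟩) := rfl

theorem gmk_one : (1 : GradedMonoid ν.Leaf) =
    GradedMonoid.mk 0 (ν.leafMk 0 ⟨1, by simpa using ν.algebraMap_mem_filtGE 1⟩) := rfl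

instance : DirectSum.GCommRing ν.Leaf where
  mul_zero {a b} x := map_zero (ν.leafMul a b x)
  zero_mul {a b} y := by
    change ν.leafMul a b 0 y = 0
    simp
  mul_add {a b} x y z := map_add (ν.leafMul a b x) y z
  add_mul {a b} x y z := by
    change ν.leafMul a b (x + y) z = ν.leafMul a b x z + ν.leafMul a b y z
    simp
  one_mul := by
    rintro ⟨a, x⟩
    obtain ⟨f, rfl⟩ := ν.leafMk_surjective a x
    rw [gmk_one]
    exact ν.gmk_eq (zero_add a) _ _ (one_mul _)
  mul_one := by
    rintro ⟨a, x⟩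
    obtain ⟨f, rfl⟩ := ν.leafMk_surjective a x
    rw [gmk_one]
    exact ν.gmk_eq (add_zero a) _ _ (mul_one _)
  mul_assoc := by
    rintro ⟨a, x⟩ ⟨b, y⟩ ⟨c, z⟩
    obtain ⟨f, rfl⟩ := ν.leafMk_surjective a x
    obtain ⟨g, rfl⟩ := ν.leafMk_surjective b y
    obtain ⟨h, rfl⟩ := ν.leafMk_surjective c z
    exact ν.gmk_eq (add_assoc a b c) _ _ (mul_assoc _ _ _)
  mul_comm := by
    rintro ⟨a, x⟩ ⟨b, y⟩
    obtain ⟨f, rfl⟩ := ν.leafMk_surjective a x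
    obtain ⟨g, rfl⟩ := ν.leafMk_surjective b y
    exact ν.gmk_eq (add_comm a b) _ _ (mul_comm _ _)
  natCast n := ν.leafMk 0 ⟨(n : R), by simpa using ν.algebraMap_mem_filtGE n⟩
  natCast_zero := by
    rw [← map_zero (ν.leafMk 0)]; congr 1; ext; simp
  natCast_succ n := by
    change _ = ν.leafMk 0 _ + ν.leafMk 0 _
    rw [← map_add]; congr 1; ext; simp
  intCast n := ν.leafMk 0 ⟨(n : R), by simpa using ν.algebraMap_mem_filtGE n⟩
  intCast_ofNat n := by
    change ν.leafMk 0 _ = ν.leafMk 0 _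
    congr 1; ext; simp
  intCast_negSucc_ofNat n := by
    change ν.leafMk 0 _ = - ν.leafMk 0 _
    rw [← map_neg]; congr 1; ext; simp

instance : DirectSum.GAlgebra K ν.Leaf where
  toFun := (ν.leafMk 0).toAddMonoidHom.comp
    ((Algebra.linearMap K R).codRestrict (ν.filtGE 0) ν.algebraMap_mem_filtGE).toAddMonoidHom
  map_one := by
    change ν.leafMk 0 _ = ν.leafMk 0 _
    congr 1; ext; exact map_one (algebraMap K R)
  map_mul r s := by
    refine ν.gmk_eq (add_zero (0 : Γ)).symm _ _ ?_
    exact map_mul (algebraMap K R) r s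
  commutes := by
    rintro r ⟨a, x⟩
    obtain ⟨f, rfl⟩ := ν.leafMk_surjective a x
    refine ν.gmk_eq ((zero_add a).trans (add_zero a).symm) _ _ ?_
    exact mul_comm _ _
  smul_def := by
    rintro r ⟨a, x⟩
    obtain ⟨f, rfl⟩ := ν.leafMk_surjective a x
    refine ν.gmk_eq (a := a) (zero_add a).symm (r • f) _ ?_
    exact Algebra.smul_def r f.1

/-- The associated graded algebra `⨁ a, F_{≥ a} / F_{> a}`. -/
abbrev Gr : Type _ := ⨁ a : Γ, ν.Leaf a

/-- The class of `f ∈ F_{≥ a}` in the associated graded algebra. -/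
def cls (a : Γ) : ν.filtGE a →ₗ[K] ν.Gr := (DirectSum.lof K Γ ν.Leaf a).comp (ν.leafMk a)

theorem cls_mul {a b : Γ} (f : ν.filtGE a) (g : ν.filtGE b) :
    ν.cls a f * ν.cls b g = ν.cls (a + b) ⟨f.1 * g.1, ν.mul_mem_filtGE f.2 g.2⟩ :=
  DirectSum.of_mul_of (A := ν.Leaf) _ _

variable (ℬ : ℕ → Submodule K R)

/-- If `R = ⨁ ℬ i` is graded: the degree `i` part of the associated graded algebra, spanned by the
classes of the elements of `R` of degree `i`. -/
def grDeg (i : ℕ) : Submodule K ν.Gr :=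
  Submodule.span K {x | ∃ (a : Γ) (f : ν.filtGE a), f.1 ∈ ℬ i ∧ ν.cls a f = x}

variable [GradedAlgebra ℬ]

/-- The filtration is compatible with the grading `ℬ` of `R`. -/
class IsHomog : Prop where
  le_proj : ∀ (f : R) (i : ℕ), ν.toFun f ≤ ν.toFun (GradedAlgebra.proj ℬ i f)

variable {ℬ}

/-- Projection of a leaf to degree `i`. -/
def leafProj (hν : ν.IsHomog ℬ) (i : ℕ) (a : Γ) : ν.Leaf a →ₗ[K] ν.Leaf a :=
  Submodule.mapQ _ _ ((GradedAlgebra.proj ℬ i).restrict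
    (p := ν.filtGE a) (q := ν.filtGE a) (fun f hf => le_trans hf (hν.le_proj f i)))
    (fun f hf => lt_of_lt_of_le hf (hν.le_proj f.1 i))

/-- Projection of the associated graded algebra to degree `i`. -/
def grProj (hν : ν.IsHomog ℬ) (i : ℕ) : ν.Gr →ₗ[K] ν.Gr :=
  DirectSum.lmap (ν.leafProj hν i)

theorem grProj_cls (hν : ν.IsHomog ℬ) (i : ℕ) (a : Γ) (f : ν.filtGE a) :
    ν.grProj hν i (ν.cls a f) =
      ν.cls a ⟨GradedAlgebra.proj ℬ i f.1, le_trans f.2 (hν.le_proj f.1 i)⟩ := by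
  simp only [grProj, cls, LinearMap.comp_apply, DirectSum.lmap_lof]
  rfl

theorem grProj_same (hν : ν.IsHomog ℬ) (i : ℕ) (x : ν.Gr) (hx : x ∈ ν.grDeg ℬ i) :
    ν.grProj hν i x = x := by
  induction hx using Submodule.span_induction with
  | mem x h =>
    obtain ⟨a, f, hf, rfl⟩ := h
    rw [grProj_cls]
    congr 1
    ext
    exact DirectSum.decompose_of_mem_same ℬ hf
  | zero => simp
  | add x y _ _ hx hy => rw [map_add, hx, hy]
  | smul c x _ hx => rw [map_smul, hx]

theorem grProj_ne (hν : ν.IsHomog ℬ) {i j : ℕ} (hij : j ≠ i) (x : ν.Gr) (hx : x ∈ ν.grDeg ℬ j) :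
    ν.grProj hν i x = 0 := by
  induction hx using Submodule.span_induction with
  | mem x h =>
    obtain ⟨a, f, hf, rfl⟩ := h
    rw [grProj_cls, ← map_zero (ν.cls a)]
    congr 1
    ext
    exact DirectSum.decompose_of_mem_ne ℬ hf hij
  | zero => simp
  | add x y _ _ hx hy => rw [map_add, hx, hy, add_zero]
  | smul c x _ hx => rw [map_smul, hx, smul_zero]

theorem iSup_grDeg (hν : ν.IsHomog ℬ) : (⨆ i, ν.grDeg ℬ i) = ⊤ := by
  classical
  rw [eq_top_iff]
  intro x _
  induction x using DirectSum.induction_on with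
  | zero => exact zero_mem _
  | add x y hx hy => exact add_mem (hx trivial) (hy trivial)
  | of a x =>
    obtain ⟨f, rfl⟩ := ν.leafMk_surjective a x
    have key : ν.cls a f ∈ ⨆ i, ν.grDeg ℬ i := by
      have hf : f = ∑ i ∈ (DirectSum.decompose ℬ f.1).support,
          (⟨GradedAlgebra.proj ℬ i f.1, le_trans f.2 (hν.le_proj f.1 i)⟩ : ν.filtGE a) := by
        ext
        rw [AddSubmonoidClass.coe_finsetSum]
        exact (DirectSum.sum_support_decompose ℬ f.1).symm
      rw [hf, map_sum]
      refine sum_mem fun i _ => Submodule.mem_iSup_of_mem i (Submodule.subset_span ⟨a, _, ?_, rfl⟩)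
      exact SetLike.coe_mem _
    exact key

theorem isInternal_grDeg (hν : ν.IsHomog ℬ) : DirectSum.IsInternal (ν.grDeg ℬ) :=
  isInternal_of_proj (ν.grProj_same hν) (fun _ _ h => ν.grProj_ne hν h) (ν.iSup_grDeg hν)

/-- The associated graded algebra inherits the grading of `R` by `ℕ`. -/
noncomputable instance grGraded [hν : ν.IsHomog ℬ] : GradedAlgebra (ν.grDeg ℬ) where
  one_mem := by
    refine Submodule.subset_span ⟨0, ⟨1, by simpa using ν.algebraMap_mem_filtGE 1⟩,
      SetLike.GradedOne.one_mem, rfl⟩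
  mul_mem {i j x y} hx hy := by
    have : ν.grDeg ℬ i * ν.grDeg ℬ j ≤ ν.grDeg ℬ (i + j) := by
      rw [grDeg, grDeg, Submodule.span_mul_span, Submodule.span_le]
      rintro _ ⟨_, ⟨a, f, hf, rfl⟩, _, ⟨b, g, hg, rfl⟩, rfl⟩
      exact Submodule.subset_span ⟨a + b, _, SetLike.GradedMul.mul_mem hf hg, (ν.cls_mul f g).symm⟩
    exact this (Submodule.mul_mem_mul hx hy)
  toDecomposition := (ν.isInternal_grDeg hν).chooseDecomposition

end QuasiValuation

/-! ### Polytopes -/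

noncomputable section

/-- The inclusion of the lattice in the real vector space. -/
def toReal {d : ℕ} (χ : Fin d → ℤ) : Fin d → ℝ := fun i => χ i

/-- A marked polytope `(P, A)` in `M_ℝ = ℝ^d` with `M = ℤ^d`: a finite set `A ⊆ M` whose affine
span is everything, together with `P = conv A` (which is determined by `A`). -/
structure MarkedPolytope (d : ℕ) where
  A : Finset (Fin d → ℤ)
  spans : affineSpan ℝ (toReal '' (A : Set (Fin d → ℤ))) = ⊤

namespace MarkedPolytope

variable {d : ℕ} (P : MarkedPolytope d)

theorem nonempty : P.A.Nonempty := by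
  rw [Finset.nonempty_iff_ne_empty]
  intro h
  have := P.spans
  rw [h] at this
  simp at this

/-- `P = conv A`. -/
def polytope : Set (Fin d → ℝ) := convexHull ℝ (toReal '' (P.A : Set (Fin d → ℤ)))

end MarkedPolytope

/-- The cone `K(D)` in `ℝ × ℝ^d` generated by `{1} × D`. -/
def cone {d : ℕ} (D : Set (Fin d → ℝ)) : PointedCone ℝ (ℝ × (Fin d → ℝ)) :=
  PointedCone.hull ℝ ((fun x => ((1 : ℝ), x)) '' D)

/-- A polytopal subdivision of `(P, A)` by marked polytopes `(Q, A_Q)`, all full-dimensional with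
`Q = conv A_Q` and `A_Q ⊆ A`: they cover `P`, two of them meet in a common face (the empty face is
allowed), and the markings agree on the intersection. -/
structure Subdivision {d : ℕ} (P : MarkedPolytope d) where
  cells : Finset (MarkedPolytope d)
  subset : ∀ B ∈ cells, B.A ⊆ P.A
  covers : ⋃ B ∈ cells, B.polytope = P.polytope
  face : ∀ B ∈ cells, ∀ B' ∈ cells, IsExposed ℝ B.polytope (B.polytope ∩ B'.polytope)
  marking : ∀ B ∈ cells, ∀ B' ∈ cells, ∀ χ ∈ B.A, toReal χ ∈ B'.polytope → χ ∈ B'.A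

theorem Subdivision.cells_nonempty {d : ℕ} {P : MarkedPolytope d} (𝒬 : Subdivision P) :
    𝒬.cells.Nonempty := by
  rw [Finset.nonempty_iff_ne_empty]
  intro h
  have hc := 𝒬.covers
  obtain ⟨χ, hχ⟩ := P.nonempty
  have : toReal χ ∈ P.polytope := subset_convexHull ℝ _ ⟨χ, hχ, rfl⟩
  rw [← hc, h] at this
  simp at this

section GKZCones

variable {d N : ℕ} {P : MarkedPolytope d} (𝒬 : Subdivision P)

/-- `g` is linear on the set `K`. -/
def LinearOn (g : ℝ × (Fin d → ℝ) → Fin N → ℝ) (K : Set (ℝ × (Fin d → ℝ))) : Prop :=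
  ∃ φ : (ℝ × (Fin d → ℝ)) →ₗ[ℝ] (Fin N → ℝ), Set.EqOn g φ K

/-- `g` is linear on each cone `K(Q)`. Only the values of `g` on `K(P)` matter. -/
def IsPiecewiseLinear (g : ℝ × (Fin d → ℝ) → Fin N → ℝ) : Prop :=
  ∀ B ∈ 𝒬.cells, LinearOn g (cone B.polytope)

/-- Convex upward maps `K → ℝ^N`, for the lexicographic order on `ℝ^N`, the entry with index `0`
being the most significant one. -/
def ConvexUpward (K : Set (ℝ × (Fin d → ℝ))) (g : ℝ × (Fin d → ℝ) → Fin N → ℝ) : Prop :=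
  ContinuousOn g K ∧ ∀ u ∈ K, ∀ v ∈ K, ∀ t : ℝ, 0 ≤ t → t ≤ 1 →
    toLex (t • g u + (1 - t) • g v) ≤ toLex (g (t • u + (1 - t) • v))

/-- `g = g_{Ψ,𝒬}`: a `𝒬`-piecewise linear convex upward map on `K(P)` with `g(χ) = Ψ(χ)` if `χ` is
in the marking of some `Q`, and `g(χ) ≥ Ψ(χ)` otherwise; `Ψ(χ)` is the column of `Ψ` at `χ`. -/
structure IsAssociatedMap (Ψ : Matrix (Fin N) P.A ℝ) (g : ℝ × (Fin d → ℝ) → Fin N → ℝ) :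
    Prop where
  piecewiseLinear : IsPiecewiseLinear 𝒬 g
  convexUpward : ConvexUpward (cone P.polytope : Set (ℝ × (Fin d → ℝ))) g
  eq_of_marked : ∀ χ : P.A, (∃ B ∈ 𝒬.cells, χ.1 ∈ B.A) → g (1, toReal χ.1) = Ψ.col χ
  le_of_unmarked : ∀ χ : P.A, (¬ ∃ B ∈ 𝒬.cells, χ.1 ∈ B.A) →
    toLex (Ψ.col χ) ≤ toLex (g (1, toReal χ.1))

/-- The closed GKZ-cone. -/
def closedGKZCone (N : ℕ) : Set (Matrix (Fin N) P.A ℝ) :=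
  {Ψ | ∃ g, IsAssociatedMap 𝒬 Ψ g}

/-- `D` is the closure of a non-empty connected (relatively) open subset of `X`. -/
def IsClosedDomain (X D : Set (Fin d → ℝ)) : Prop :=
  ∃ O : Set (Fin d → ℝ), IsOpen O ∧ _root_.IsConnected (O ∩ X) ∧ D = closure (O ∩ X)

/-- Domains of linearity of `g`: the maximal domains in `P` such that `g` is linear on `K(D)`. -/
structure IsDomainOfLinearity (P : MarkedPolytope d) (g : ℝ × (Fin d → ℝ) → Fin N → ℝ)
    (D : Set (Fin d → ℝ)) : Prop where
  isDomain : IsClosedDomain P.polytope D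
  linearOn : LinearOn g (cone D)
  maximal : ∀ D', IsClosedDomain P.polytope D' → LinearOn g (cone D') → D ⊆ D' → D' = D

/-- The marking `{χ ∈ A ∩ D | g(χ) = Ψ(χ)}` of `D`. -/
def domainMarking (Ψ : Matrix (Fin N) P.A ℝ) (g : ℝ × (Fin d → ℝ) → Fin N → ℝ)
    (D : Set (Fin d → ℝ)) : Set (Fin d → ℤ) :=
  {χ | ∃ h : χ ∈ P.A, toReal χ ∈ D ∧ g (1, toReal χ) = Ψ.col ⟨χ, h⟩}

/-- The open GKZ-cone `C(𝒬, N)`: the matrices in the closed GKZ-cone such that the domains of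
linearity of `g_{Ψ,𝒬}`, with their markings, are exactly the marked polytopes in `𝒬`. -/
def openGKZCone (N : ℕ) : Set (Matrix (Fin N) P.A ℝ) :=
  {Ψ | ∃ g, IsAssociatedMap 𝒬 Ψ g ∧
    {X : Set (Fin d → ℝ) × Set (Fin d → ℤ) |
      IsDomainOfLinearity P g X.1 ∧ X.2 = domainMarking Ψ g X.1} =
    {X | ∃ B ∈ 𝒬.cells, X = (B.polytope, (B.A : Set (Fin d → ℤ)))}}

end GKZCones

/-! ### The toric variety -/

section Toric

variable (K : Type u) [Field K] {d : ℕ} (P : MarkedPolytope d)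

/-- The monoid `S` generated by the elements `(1, χ)`, `χ ∈ A`. As all degrees are non-negative, it
lives in `ℕ × M ⊆ ℤ × M`. -/
def monoidS : AddSubmonoid (ℕ × (Fin d → ℤ)) :=
  AddSubmonoid.closure ((fun χ => (1, χ)) '' (P.A : Set (Fin d → ℤ)))

/-- The inclusion of `ℕ × M` in `ℝ × M_ℝ`. -/
def latticeToReal : ℕ × (Fin d → ℤ) →+ ℝ × (Fin d → ℝ) where
  toFun u := (u.1, toReal u.2)
  map_zero' := by ext <;> simp [toReal]
  map_add' u v := by ext <;> simp [toReal]

/-- `(1, χ)` as an element of `S`. -/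
def gen (χ : P.A) : monoidS P := ⟨(1, χ.1), AddSubmonoid.subset_closure ⟨χ.1, χ.2, rfl⟩⟩

/-- The degree `d_u` of `u = (d_u, η_u)`. -/
def deg (S : AddSubmonoid (ℕ × (Fin d → ℤ))) : S →+ ℕ := (AddMonoidHom.fst ℕ _).comp S.subtype

/-- The map `K^* × T → K^A`, `(c, t) ↦ (c χ(t))_χ`, where `T = (K^*)^d`. The Zariski closure of its
image is the affine cone over the embedded toric variety `X_A ⊆ ℙ(K^A)`. -/
def torusMap (ct : Kˣ × (Fin d → Kˣ)) (χ : P.A) : K :=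
  ((ct.1 * ∏ i, ct.2 i ^ χ.1 i : Kˣ) : K)

/-- The coordinate ring of the affine cone over `X_A`, i.e. the homogeneous coordinate ring of
`X_A`: polynomials modulo those that vanish on the image of the torus. -/
abbrev CoordRing : Type u :=
  MvPolynomial P.A K ⧸ MvPolynomial.vanishingIdeal K (Set.range (torusMap K P))

/-- `x_χ ↦ (1, χ)`. -/
def toMonoidAlgebra : MvPolynomial P.A K →ₐ[K] AddMonoidAlgebra K (monoidS P) :=
  MvPolynomial.aeval fun χ => AddMonoidAlgebra.single (gen P χ) 1

/-- The character of the torus belonging to `u`. -/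
def character (u : ℕ × (Fin d → ℤ)) : (Kˣ × (Fin d → Kˣ)) →* K where
  toFun ct := ((ct.1 ^ u.1 * ∏ i, ct.2 i ^ u.2 i : Kˣ) : K)
  map_one' := by simp
  map_mul' a b := by
    rw [← Units.val_mul]
    congr 1
    simp only [Prod.fst_mul, Prod.snd_mul, Pi.mul_apply, mul_pow, mul_zpow,
      Finset.prod_mul_distrib]
    exact mul_mul_mul_comm _ _ _ _

theorem character_injective [CharZero K] :
    Function.Injective (character K : ℕ × (Fin d → ℤ) → _) := by
  have h2 : ∀ a b : ℤ, (Units.mk0 (2 : K) two_ne_zero) ^ a = (Units.mk0 (2 : K) two_ne_zero) ^ b →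
      a = b := by
    intro a b h
    have h' := congrArg (Units.val) h
    simp only [Units.val_zpow_eq_zpow_val, Units.val_mk0] at h'
    have h3 : ((2 : ℚ) ^ a : ℚ) = 2 ^ b := by
      have h4 : (((2 : ℚ) ^ a : ℚ) : K) = (((2 : ℚ) ^ b : ℚ) : K) := by
        push_cast
        exact h'
      exact Rat.cast_injective h4
    exact zpow_right_injective₀ (by norm_num) (by norm_num) h3
  intro u v h
  ext i
  · have := DFunLike.congr_fun h (Units.mk0 (2 : K) two_ne_zero, 1)
    simp only [character, MonoidHom.coe_mk, OneHom.coe_mk, Pi.one_apply, one_zpow,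
      Finset.prod_const_one, mul_one] at this
    have h' := Units.ext this
    exact_mod_cast h2 u.1 v.1 (by simpa using h')
  · have := DFunLike.congr_fun h (1, Pi.mulSingle i (Units.mk0 (2 : K) two_ne_zero))
    simp only [character, MonoidHom.coe_mk, OneHom.coe_mk, one_pow, one_mul] at this
    have h' := Units.ext this
    have h4 : ∀ w : Fin d → ℤ, ∏ j, (Pi.mulSingle i (Units.mk0 (2 : K) two_ne_zero) :
        Fin d → Kˣ) j ^ w j = (Units.mk0 (2 : K) two_ne_zero) ^ w i := by
      intro w
      rw [Finset.prod_eq_single i]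
      · simp
      · intro j _ hj; simp [Pi.mulSingle_eq_of_ne hj]
      · simp
    rw [h4, h4] at h'
    exact h2 _ _ h'

/-- Evaluation of elements of the monoid algebra at points of the torus. -/
def evalTorus (ct : Kˣ × (Fin d → Kˣ)) : AddMonoidAlgebra K (monoidS P) →ₐ[K] K :=
  AddMonoidAlgebra.lift K K (monoidS P)
    { toFun := fun u => character K u.toAdd.1 ct
      map_one' := by simp [character]
      map_mul' := fun u v => by
        simp only [character, MonoidHom.coe_mk, OneHom.coe_mk, toAdd_mul, AddSubmonoid.coe_add,
          Prod.fst_add, Prod.snd_add, Pi.add_apply, pow_add, zpow_add, Finset.prod_mul_distrib]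
        rw [← Units.val_mul]
        congr 1
        exact mul_mul_mul_comm _ _ _ _ }

theorem evalTorus_toMonoidAlgebra (ct : Kˣ × (Fin d → Kˣ)) (f : MvPolynomial P.A K) :
    evalTorus K P ct (toMonoidAlgebra K P f) = MvPolynomial.aeval (torusMap K P ct) f := by
  have : (evalTorus K P ct).comp (toMonoidAlgebra K P) = MvPolynomial.aeval (torusMap K P ct) := by
    ext χ
    simp [evalTorus, toMonoidAlgebra, torusMap, character, gen]
  exact DFunLike.congr_fun this f

theorem toMonoidAlgebra_surjective : Function.Surjective (toMonoidAlgebra K P) := by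
  have key : ∀ u (hu : u ∈ monoidS P), ∃ f, toMonoidAlgebra K P f =
      AddMonoidAlgebra.single (⟨u, hu⟩ : monoidS P) 1 := by
    intro u hu
    induction hu using AddSubmonoid.closure_induction with
    | mem u h =>
      obtain ⟨χ, hχ, rfl⟩ := h
      exact ⟨MvPolynomial.X ⟨χ, hχ⟩, by simp [toMonoidAlgebra, gen]⟩
    | zero => exact ⟨1, by rw [map_one]; rfl⟩
    | add u v _ _ hu hv =>
      obtain ⟨f, hf⟩ := hu
      obtain ⟨g, hg⟩ := hv
      refine ⟨f * g, ?_⟩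
      rw [map_mul, hf, hg, AddMonoidAlgebra.single_mul_single, mul_one]
      rfl
  intro F
  induction F using AddMonoidAlgebra.induction_linear with
  | zero => exact ⟨0, map_zero _⟩
  | add F G hF hG =>
    obtain ⟨f, rfl⟩ := hF
    obtain ⟨g, rfl⟩ := hG
    exact ⟨f + g, map_add _ _ _⟩
  | single u c =>
    obtain ⟨f, hf⟩ := key u.1 u.2
    refine ⟨c • f, ?_⟩
    rw [map_smul, hf]
    simp

theorem ker_toMonoidAlgebra [CharZero K] :
    MvPolynomial.vanishingIdeal K (Set.range (torusMap K P)) =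
      RingHom.ker (toMonoidAlgebra K P) := by
  ext f
  rw [MvPolynomial.mem_vanishingIdeal_iff, RingHom.mem_ker, Set.forall_mem_range]
  simp_rw [← evalTorus_toMonoidAlgebra]
  constructor
  · intro h
    set F := toMonoidAlgebra K P f
    have hli := (linearIndependent_monoidHom (Kˣ × (Fin d → Kˣ)) K).comp
      (fun u : monoidS P => character K u.1) ((character_injective K).comp Subtype.val_injective)
    rw [linearIndependent_iff] at hli
    have := hli F.coeff (by
      ext ct
      have hct := h ct
      simp only [evalTorus, AddMonoidAlgebra.lift_apply] at hct
      simpa [Finsupp.linearCombination_apply, Finsupp.sum, Finset.sum_apply] using hct)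
    exact AddMonoidAlgebra.coeff_injective this
  · intro h ct
    rw [h, map_zero]

/-- The identification of the coordinate ring with the monoid algebra of `S`. -/
def coordEquiv [CharZero K] : CoordRing K P ≃ₐ[K] AddMonoidAlgebra K (monoidS P) :=
  (Ideal.quotientEquivAlgOfEq K (ker_toMonoidAlgebra K P)).trans
    (Ideal.quotientKerAlgEquivOfSurjective (toMonoidAlgebra_surjective K P))

variable {P}

/-- The projection of the monoid algebra to degree `i`. -/
def restrictDeg (S : AddSubmonoid (ℕ × (Fin d → ℤ))) (i : ℕ) :
    AddMonoidAlgebra K S →ₗ[K] AddMonoidAlgebra K S where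
  toFun F := .ofCoeff (F.coeff.filter fun u => deg S u = i)
  map_add' F G := by ext u; by_cases h : deg S u = i <;> simp [h]
  map_smul' c F := by ext u; by_cases h : deg S u = i <;> simp [h]

variable (P)

/-- The elements of degree `i` in the homogeneous coordinate ring: classes of homogeneous
polynomials of degree `i`. -/
def coordGrade (i : ℕ) : Submodule K (CoordRing K P) :=
  (MvPolynomial.homogeneousSubmodule P.A K i).map
    (Ideal.Quotient.mkₐ K (MvPolynomial.vanishingIdeal K (Set.range (torusMap K P)))).toLinearMap

theorem coordEquiv_mk [CharZero K] (f : MvPolynomial P.A K) :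
    coordEquiv K P (Ideal.Quotient.mkₐ K _ f) = toMonoidAlgebra K P f := rfl

theorem toMonoidAlgebra_monomial (α : P.A →₀ ℕ) (c : K) :
    toMonoidAlgebra K P (MvPolynomial.monomial α c) =
      AddMonoidAlgebra.single (α.sum fun χ n => n • gen P χ) c := by
  rw [MvPolynomial.monomial_eq, map_mul, MvPolynomial.algHom_C, Finsupp.prod, map_prod]
  have : ∀ χ ∈ α.support, toMonoidAlgebra K P (MvPolynomial.X χ ^ α χ) =
      AddMonoidAlgebra.single (α χ • gen P χ) 1 := by
    intro χ _
    simp [toMonoidAlgebra, AddMonoidAlgebra.single_pow]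
  rw [Finset.prod_congr rfl this, AddMonoidAlgebra.coe_algebraMap, Finsupp.sum]
  have h2 : ∀ s : Finset P.A, ∏ χ ∈ s, (AddMonoidAlgebra.single (α χ • gen P χ) (1 : K)) =
      AddMonoidAlgebra.single (∑ χ ∈ s, α χ • gen P χ) 1 := by
    classical
    intro s
    induction s using Finset.induction_on with
    | empty => simp [AddMonoidAlgebra.one_def]
    | insert a s ha ih =>
      rw [Finset.prod_insert ha, ih, Finset.sum_insert ha, AddMonoidAlgebra.single_mul_single,
        mul_one]
  rw [h2]
  simp [AddMonoidAlgebra.single_mul_single]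

theorem deg_sum_gen (α : P.A →₀ ℕ) :
    deg (monoidS P) (α.sum fun χ n => n • gen P χ) = α.degree := by
  rw [Finsupp.sum, map_sum, Finsupp.degree]
  refine Finset.sum_congr rfl fun χ _ => ?_
  rw [map_nsmul]
  simp [deg, gen]

theorem coordEquiv_mem [CharZero K] {i : ℕ} {x : CoordRing K P} (hx : x ∈ coordGrade K P i) :
    coordEquiv K P x ∈ AddMonoidAlgebra.gradeBy K (deg (monoidS P)) i := by
  obtain ⟨f, hf, rfl⟩ := hx
  change toMonoidAlgebra K P f ∈ _
  rw [f.as_sum, map_sum]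
  refine sum_mem fun α hα => ?_
  rw [toMonoidAlgebra_monomial]
  have h : α.degree = i := by
    rw [Finsupp.degree_eq_weight_one]
    exact hf (MvPolynomial.mem_support_iff.1 hα)
  have := AddMonoidAlgebra.single_mem_gradeBy (deg (monoidS P)) (α.sum fun χ n => n • gen P χ)
    (f.coeff α)
  rwa [deg_sum_gen, h] at this

/-- The projection of the coordinate ring to degree `i`. -/
def coordProj [CharZero K] (i : ℕ) : CoordRing K P →ₗ[K] CoordRing K P :=
  (coordEquiv K P).symm.toLinearMap ∘ₗ restrictDeg K (monoidS P) i ∘ₗ (coordEquiv K P).toLinearMap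

theorem coordProj_same [CharZero K] (i : ℕ) (x : CoordRing K P) (hx : x ∈ coordGrade K P i) :
    coordProj K P i x = x := by
  have h := coordEquiv_mem K P hx
  apply (coordEquiv K P).injective
  simp only [coordProj, LinearMap.comp_apply, AlgEquiv.toLinearMap_apply,
    AlgEquiv.apply_symm_apply]
  ext u
  by_cases hu : deg (monoidS P) u = i
  · simp [restrictDeg, hu]
  · have : (coordEquiv K P x).coeff u = 0 := by
      by_contra h0
      exact hu (h u (Finsupp.mem_support_iff.2 h0))
    simp [restrictDeg, hu, this]

theorem coordProj_ne [CharZero K] (i j : ℕ) (hij : j ≠ i) (x : CoordRing K P)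
    (hx : x ∈ coordGrade K P j) : coordProj K P i x = 0 := by
  have h := coordEquiv_mem K P hx
  apply (coordEquiv K P).injective
  simp only [coordProj, LinearMap.comp_apply, AlgEquiv.toLinearMap_apply,
    AlgEquiv.apply_symm_apply, map_zero]
  ext u
  by_cases hu : deg (monoidS P) u = i
  · have : (coordEquiv K P x).coeff u = 0 := by
      by_contra h0
      exact hij ((h u (Finsupp.mem_support_iff.2 h0)).symm.trans hu)
    simp [restrictDeg, hu, this]
  · simp [restrictDeg, hu]

theorem iSup_coordGrade : (⨆ i, coordGrade K P i) = ⊤ := by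
  rw [eq_top_iff]
  intro x _
  obtain ⟨f, rfl⟩ := Ideal.Quotient.mkₐ_surjective K _ x
  rw [← MvPolynomial.sum_homogeneousComponent f, map_sum]
  exact sum_mem fun i _ => Submodule.mem_iSup_of_mem i
    ⟨_, MvPolynomial.homogeneousComponent_mem i f, rfl⟩

instance coordGraded [CharZero K] : GradedAlgebra (coordGrade K P) where
  one_mem := ⟨1, MvPolynomial.isHomogeneous_one _ _, rfl⟩
  mul_mem := by
    rintro i j _ _ ⟨f, hf, rfl⟩ ⟨g, hg, rfl⟩
    exact ⟨f * g, MvPolynomial.IsHomogeneous.mul hf hg, rfl⟩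
  toDecomposition := (isInternal_of_proj (coordProj_same K P) (coordProj_ne K P)
    (iSup_coordGrade K P)).chooseDecomposition

theorem proj_eq_coordProj [CharZero K] (i : ℕ) (x : CoordRing K P) :
    GradedAlgebra.proj (coordGrade K P) i x = coordProj K P i x := by
  have h := proj_coe_apply (coordProj_same K P) (coordProj_ne K P) i
    (DirectSum.decompose (coordGrade K P) x)
  have h2 : DirectSum.coeAddMonoidHom (coordGrade K P) (DirectSum.decompose (coordGrade K P) x) = x :=
    (DirectSum.decompose (coordGrade K P)).symm_apply_apply x
  rw [h2] at h
  exact h.symm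

/-- The element `f_u` of the basis `{f_u | u ∈ S}` of the coordinate ring. -/
def basisFn [CharZero K] (u : monoidS P) : CoordRing K P :=
  (coordEquiv K P).symm (AddMonoidAlgebra.single u 1)

/-- `f_u` is the class of every monomial `x^α` with `∑ α_χ (1, χ) = u`. -/
theorem basisFn_eq_monomial [CharZero K] (α : P.A →₀ ℕ) :
    basisFn K P (α.sum fun χ n => n • gen P χ) =
      Ideal.Quotient.mkₐ K _ (MvPolynomial.monomial α (1 : K)) := by
  rw [basisFn, AlgEquiv.symm_apply_eq, coordEquiv_mk, toMonoidAlgebra_monomial]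

section Weight

variable {Γ : Type*} [AddCommGroup Γ] [LinearOrder Γ] [IsOrderedAddMonoid Γ]

/-- The quasi-valuation `∑ a_u f_u ↦ min {h(u) | a_u ≠ 0}` for a super-additive `h : S → Γ`. -/
def weightValuation [CharZero K] (h : monoidS P → Γ) (h0 : h 0 = 0)
    (hadd : ∀ u v, h u + h v ≤ h (u + v)) : QuasiValuation K (CoordRing K P) Γ where
  toFun f := (coordEquiv K P f).coeff.support.inf fun u => (h u : WithTop Γ)
  eq_top_iff' f := by
    rw [Finset.inf_eq_top_iff]
    constructor
    · intro H
      have : (coordEquiv K P f).coeff = 0 := by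
        rw [← Finsupp.support_eq_empty, Finset.eq_empty_iff_forall_notMem]
        exact fun u hu => WithTop.coe_ne_top (H u hu)
      exact (map_eq_zero_iff _ (coordEquiv K P).injective).1
        (AddMonoidAlgebra.coeff_injective this)
    · rintro rfl
      simp
  min_le_add' f g := by
    classical
    refine le_trans (le_of_eq Finset.inf_union.symm) (Finset.inf_mono ?_)
    rw [map_add, AddMonoidAlgebra.coeff_add]
    exact Finsupp.support_add
  smul' c f hc := by
    rw [map_smul, AddMonoidAlgebra.coeff_smul, Finsupp.support_smul_eq hc]
  add_le_mul' f g := by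
    classical
    refine Finset.le_inf fun w hw => ?_
    rw [map_mul] at hw
    obtain ⟨u, hu, v, hv, rfl⟩ := Finset.mem_add.1 (AddMonoidAlgebra.support_coeff_mul_subset _ _ hw)
    refine (add_le_add (Finset.inf_le hu) (Finset.inf_le hv)).trans ?_
    rw [← WithTop.coe_add]
    exact WithTop.coe_le_coe.2 (hadd u v)
  map_one' := by
    have hs : (Finsupp.single (0 : monoidS P) (1 : K)).support = {0} :=
      Finsupp.support_single _ one_ne_zero
    rw [map_one, AddMonoidAlgebra.one_def, AddMonoidAlgebra.coeff_single, hs,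
      Finset.inf_singleton, h0, WithTop.coe_zero]

theorem weightValuation_isHomog [CharZero K] (h : monoidS P → Γ) (h0 : h 0 = 0)
    (hadd : ∀ u v, h u + h v ≤ h (u + v)) :
    (weightValuation K P h h0 hadd).IsHomog (coordGrade K P) := by
  constructor
  intro f i
  rw [proj_eq_coordProj]
  refine Finset.inf_mono fun u hu => ?_
  simp only [coordProj, LinearMap.comp_apply, AlgEquiv.toLinearMap_apply,
    AlgEquiv.apply_symm_apply, restrictDeg, LinearMap.coe_mk, AddHom.coe_mk,
    Finsupp.support_filter, Finset.mem_filter] at hu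
  exact hu.1

end Weight

section Valuation

/-- `ℚ^N` with the lexicographic order, the entry with index `0` being the most significant one. -/
def ValueGroup (N : ℕ) : Type := Lex (Fin N → ℚ)

instance (N : ℕ) : AddCommGroup (ValueGroup N) := inferInstanceAs (AddCommGroup (Lex (Fin N → ℚ)))

instance (N : ℕ) : LinearOrder (ValueGroup N) := inferInstanceAs (LinearOrder (Lex (Fin N → ℚ)))

instance (N : ℕ) : IsOrderedAddMonoid (ValueGroup N) :=
  inferInstanceAs (IsOrderedAddMonoid (Lex (Fin N → ℚ)))

/-- The identity map from `ℚ^N` to the ordered group `ℚ^N`. -/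
def toValue {N : ℕ} : (Fin N → ℚ) →+ ValueGroup N where
  toFun a := toLex a
  map_zero' := rfl
  map_add' _ _ := rfl

variable {P} {N : ℕ} (𝒬 : Subdivision P) (Ψ : Matrix (Fin N) P.A ℚ)

/-- The inclusion of `ℕ × M` in `ℚ × M_ℚ`. -/
def latticeToRat : ℕ × (Fin d → ℤ) →+ ℚ × (Fin d → ℚ) where
  toFun u := (u.1, fun i => (u.2 i : ℚ))
  map_zero' := by ext <;> simp
  map_add' u v := by ext <;> simp

open Classical in
/-- The linear map `ψ_Q : ℚ × M_ℚ → ℚ^N` determined by `ψ_Q(χ) = Ψ(χ)` for `χ ∈ A_Q` (and `0` if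
there is no such map, which does not happen for `Ψ` in the closed GKZ-cone). -/
def cellMap (Q : MarkedPolytope d) : ℚ × (Fin d → ℚ) →ₗ[ℚ] (Fin N → ℚ) :=
  if h : ∃ ψ : ℚ × (Fin d → ℚ) →ₗ[ℚ] (Fin N → ℚ),
      ∀ χ : P.A, χ.1 ∈ Q.A → ψ (latticeToRat (1, χ.1)) = Ψ.col χ
  then h.choose else 0

/-- `g_Ψ(u) = min {ψ_Q(u) | Q ∈ 𝒬}` for `u ∈ S`. -/
def weight (u : monoidS P) : ValueGroup N :=
  𝒬.cells.inf' 𝒬.cells_nonempty fun Q => toValue (cellMap Ψ Q (latticeToRat u.1))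

theorem weight_zero : weight 𝒬 Ψ 0 = 0 := by
  have : ∀ Q ∈ 𝒬.cells, toValue (cellMap Ψ Q (latticeToRat (0 : monoidS P).1)) = 0 := by
    intro Q _
    rw [AddSubmonoid.coe_zero, map_zero, map_zero, map_zero]
  rw [weight, Finset.inf'_congr 𝒬.cells_nonempty rfl this, Finset.inf'_const]

theorem weight_add (u v : monoidS P) : weight 𝒬 Ψ u + weight 𝒬 Ψ v ≤ weight 𝒬 Ψ (u + v) := by
  refine Finset.le_inf' _ _ fun Q hQ => ?_
  rw [AddSubmonoid.coe_add, map_add, map_add, map_add]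
  exact add_le_add (Finset.inf'_le _ hQ) (Finset.inf'_le _ hQ)

/-- The quasi-valuation `𝒱_Ψ`, `∑ a_u f_u ↦ min {ψ_Q(u) | Q ∈ 𝒬, a_u ≠ 0}`. -/
def quasiVal [CharZero K] : QuasiValuation K (CoordRing K P) (ValueGroup N) :=
  weightValuation K P (weight 𝒬 Ψ) (weight_zero 𝒬 Ψ) (weight_add 𝒬 Ψ)

instance quasiVal_isHomog [CharZero K] : (quasiVal K 𝒬 Ψ).IsHomog (coordGrade K P) :=
  weightValuation_isHomog K P _ (weight_zero 𝒬 Ψ) (weight_add 𝒬 Ψ)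

/-- The associated graded algebra of `𝒱_Ψ`. -/
abbrev GrV [CharZero K] : Type u := (quasiVal K 𝒬 Ψ).Gr

/-- Its grading by `ℕ`, inherited from the homogeneous coordinate ring. -/
abbrev grVDeg [CharZero K] : ℕ → Submodule K (GrV K 𝒬 Ψ) :=
  (quasiVal K 𝒬 Ψ).grDeg (coordGrade K P)

theorem basisFn_mem [CharZero K] (u : monoidS P) :
    basisFn K P u ∈ (quasiVal K 𝒬 Ψ).filtGE (weight 𝒬 Ψ u) := by
  change (weight 𝒬 Ψ u : WithTop (ValueGroup N)) ≤
    (coordEquiv K P (basisFn K P u)).coeff.support.inf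
      fun v => (weight 𝒬 Ψ v : WithTop (ValueGroup N))
  have hs : (Finsupp.single u (1 : K)).support = {u} := Finsupp.support_single _ one_ne_zero
  rw [basisFn, AlgEquiv.apply_symm_apply, AddMonoidAlgebra.coeff_single, hs,
    Finset.inf_singleton]

/-- The class of `f_u` in the associated graded algebra. -/
def grBasisFn [CharZero K] (u : monoidS P) : GrV K 𝒬 Ψ :=
  (quasiVal K 𝒬 Ψ).cls (weight 𝒬 Ψ u) ⟨basisFn K P u, basisFn_mem K 𝒬 Ψ u⟩

end Valuation

/-- The monoid `S_Q = S ∩ K(Q)`. -/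
def monoidSQ (Q : MarkedPolytope d) : AddSubmonoid (ℕ × (Fin d → ℤ)) :=
  monoidS P ⊓ (cone Q.polytope).toAddSubmonoid.comap latticeToReal

/-- The grading of a monoid algebra by the degree of `u = (d_u, η_u)`. -/
abbrev monoidGrade (S : AddSubmonoid (ℕ × (Fin d → ℤ))) :
    ℕ → Submodule K (AddMonoidAlgebra K S) :=
  AddMonoidAlgebra.gradeBy K (deg S)

open AlgebraicGeometry CategoryTheory in
/-- The structure morphism of `Proj` of a graded `K`-algebra. -/
def projStr {A : Type u} [CommRing A] [Algebra K A] (𝒜 : ℕ → Submodule K A) [GradedAlgebra 𝒜] :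
    Proj 𝒜 ⟶ Spec (.of K) :=
  Proj.toSpecZero 𝒜 ≫ Spec.map (CommRingCat.ofHom (algebraMap K (𝒜 0)))

end Toric

end

end GKZ

open AlgebraicGeometry CategoryTheory GKZ

/-!
The algebra `gr` of the quasi-valuation has the basis of the classes `f̄_u`, `u ∈ S`, and
`f̄_u f̄_v` is `f̄_{u+v}` if `g_Ψ(u + v) = g_Ψ(u) + g_Ψ(v)` and `0` otherwise. Let `ψ_Q` be the linear
map of the cell `Q`. Since the cells are the domains of linearity of the concave map `g_Ψ`, we
have `g_Ψ ≤ ψ_Q` on `K(P)`, with equality exactly on `K(Q)`: the locus of equality is closed and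
convex, so it would be a larger domain of linearity otherwise (`IsAssociatedMap.le_cellMap`,
`IsAssociatedMap.mem_polytope_of_eq`, `isAdapted_of_mem_openGKZCone`). Hence `f̄_u f̄_v ≠ 0` with
`u + v ∈ S_Q` exactly if `u` and `v` both lie in `S_Q` (`IsAdapted.add_mem_iff`).

So `f̄_u ↦ χ^u` for `u ∈ S_Q`, and `f̄_u ↦ 0` for the other `u`, defines a surjective graded
homomorphism `gr → K[S_Q]` (`grToCell`). As the cones `K(Q)` cover `K(P)`, these homomorphisms
embed `gr` in the product of the domains `K[S_Q]` (`grToCells_injective`), and the image, which is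
spanned by the images of the `f̄_u`, does not involve `Ψ`. This makes `gr` reduced and independent
of `Ψ` (`exists_grV_algEquiv`). It is finitely generated because the `S_Q` are (`monoidSQ_fg`).

On `Proj`, surjective graded homomorphisms induce closed immersions
(`isClosedImmersion_projMap_of_surjective`). The images of the `X_Q = Proj K[S_Q]` are the zero
loci of the kernels, which intersect in `0`, so that every homogeneous prime contains one of them.
The sum `u` of the `(1, χ)` with `χ` in the marking of `Q` lies in no `S_{Q'}` with `Q' ≠ Q`
(`eq_of_markingSum_mem`), so `f̄_u` vanishes on the other `X_{Q'}` but not on `X_Q`. Finally,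
`Proj K[M]` has dimension `d` for every finitely generated monoid `M ⊆ ℕ × ℤ^d` of full rank whose
only element of degree `0` is `0` (`topologicalKrullDim_proj_monoidAlgebra`): it is covered by the
charts of monomials, whose rings are finitely generated and have the Laurent polynomials in `d`
variables as an algebraic extension. This applies to the `X_Q`, and to `X_A = Proj K[S]`.
-/

namespace GKZ

universe v

/-! ### Krull dimension -/

/-- The dimension of a space covered by open subspaces of the same dimension: a chain of irreducible
closed sets can be observed in any member of the cover that meets its smallest set. -/
theorem topologicalKrullDim_eq_of_isOpenEmbedding {X ι : Type*} [TopologicalSpace X] [Nonempty ι]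
    {U : ι → Type*} [∀ i, TopologicalSpace (U i)] (f : ∀ i, U i → X)
    (hf : ∀ i, Topology.IsOpenEmbedding (f i)) (hcov : ∀ x, ∃ i, x ∈ Set.range (f i))
    {n : WithBot ℕ∞} (hn : ∀ i, topologicalKrullDim (U i) = n) : topologicalKrullDim X = n := by
  refine le_antisymm ?_ ?_
  · rw [topologicalKrullDim, Order.krullDim_eq_iSup_coheight]
    refine iSup_le fun Z => ?_
    obtain ⟨z, hz⟩ := Z.2.nonempty
    obtain ⟨i, y, rfl⟩ := hcov z
    let e := TopologicalSpace.IrreducibleCloseds.orderIsoOfIsOpenEmbedding (f i) (hf i)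
    have h := e.apply_symm_apply ⟨Z, ⟨y, hz⟩⟩
    have h' : TopologicalSpace.IrreducibleCloseds.map (f i) (hf i).continuous
        (e.symm ⟨Z, ⟨y, hz⟩⟩) = Z := congrArg Subtype.val h
    rw [← h', (hf i).coheight_map, ← hn i]
    exact Order.coheight_le_krullDim _
  · obtain ⟨i⟩ := ‹Nonempty ι›
    rw [← hn i]
    exact (hf i).isInducing.topologicalKrullDim_le

theorem ringKrullDim_eq_of_isIntegral {R S : Type*} [CommRing R] [CommRing S] [Algebra R S]
    [Algebra.IsIntegral R S] (hinj : Function.Injective (algebraMap R S)) :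
    ringKrullDim S = ringKrullDim R := by
  refine le_antisymm ?_ ?_
  · refine Order.krullDim_le_of_strictMono (PrimeSpectrum.comap (algebraMap R S)) ?_
    intro p q hpq
    have := Ideal.IsIntegral.comap_lt_comap (R := R) (I := p.asIdeal) (J := q.asIdeal) hpq
    exact this
  · have := (faithfulSMul_iff_algebraMap_injective R S).2 hinj
    refine iSup_le fun l => ?_
    obtain ⟨P, hP⟩ := Algebra.IsIntegral.comap_surjective R S l.head
    have : P.asIdeal.LiesOver l.head.asIdeal := ⟨congrArg PrimeSpectrum.asIdeal hP.symm⟩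
    obtain ⟨L, hL, -⟩ := Ideal.exists_ltSeries_of_hasGoingUp l P.asIdeal
    rw [← hL]
    exact le_iSup (fun l : LTSeries (PrimeSpectrum S) => (l.length : WithBot ℕ∞)) L

theorem trdeg_eq_of_isAlgebraic (k R S : Type v) [Field k] [CommRing R] [CommRing S] [IsDomain S]
    [Algebra k R] [Algebra k S] [Algebra R S] [IsScalarTower k R S] [FaithfulSMul R S]
    [Nontrivial R] [Algebra.IsAlgebraic R S] : Algebra.trdeg k R = Algebra.trdeg k S := by
  rw [← _root_.trdeg_add_eq k R (A := S), _root_.trdeg_eq_zero (R := R), add_zero]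

/-- By Noether normalization, the dimension of an affine domain is its transcendence degree. -/
theorem ringKrullDim_eq_trdeg (k : Type v) {R : Type v} [Field k] [CommRing R] [IsDomain R]
    [Algebra k R] [Algebra.FiniteType k R] {n : ℕ} (hn : Algebra.trdeg k R = n) :
    ringKrullDim R = n := by
  obtain ⟨s, g, hg, hint⟩ := exists_integral_inj_algHom_of_fg k R
  let _ : Algebra (MvPolynomial (Fin s) k) R := g.toRingHom.toAlgebra
  have : IsScalarTower k (MvPolynomial (Fin s) k) R :=
    IsScalarTower.of_algebraMap_eq fun x => (g.commutes x).symm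
  have : Algebra.IsIntegral (MvPolynomial (Fin s) k) R := ⟨hint⟩
  have : FaithfulSMul (MvPolynomial (Fin s) k) R :=
    (faithfulSMul_iff_algebraMap_injective _ _).2 hg
  have hs : Algebra.trdeg k R = s := by
    rw [← trdeg_eq_of_isAlgebraic k (MvPolynomial (Fin s) k) R, MvPolynomial.trdeg_of_isDomain]
    simp
  rw [ringKrullDim_eq_of_isIntegral (R := MvPolynomial (Fin s) k) hg,
    MvPolynomial.ringKrullDim_of_isNoetherianRing, ringKrullDim_eq_zero_of_field, zero_add]
  rw [hs, Nat.cast_inj] at hn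
  simp [hn]

/-! ### Functoriality of `Proj` -/

section ProjMap

open HomogeneousIdeal HomogeneousLocalization Graded

variable {A B : Type v} [CommRing A] [CommRing B] {σ τ : Type v} [SetLike σ A]
  [AddSubgroupClass σ A] [SetLike τ B] [AddSubgroupClass τ B] {𝒜 : ℕ → σ} {ℬ : ℕ → τ}
  [GradedRing 𝒜] [GradedRing ℬ]

theorem exists_homogeneous_preimage (f : 𝒜 →+*ᵍ ℬ) (hf : Function.Surjective f) {i : ℕ} {y : B}
    (hy : y ∈ ℬ i) : ∃ x ∈ 𝒜 i, f x = y := by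
  obtain ⟨x, rfl⟩ := hf y
  refine ⟨DirectSum.decompose 𝒜 x i, SetLike.coe_mem _, ?_⟩
  rw [GradedRingHom.map_directSumDecompose, DirectSum.decompose_of_mem_same _ hy]

theorem irrelevant_le_map_of_surjective (f : 𝒜 →+*ᵍ ℬ) (hf : Function.Surjective f) :
    ℬ₊ ≤ 𝒜₊.map f := by
  rw [irrelevant_le]
  intro i hi y hy
  obtain ⟨x, hx, rfl⟩ := exists_homogeneous_preimage f hf hy
  exact Ideal.mem_map_of_mem f (mem_irrelevant_of_mem 𝒜 hi hx)

variable (f : 𝒜 →+*ᵍ ℬ) (hf : Function.Surjective f)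

/-- The image is the zero locus of the kernel. -/
theorem range_projMap_of_surjective :
    Set.range (Proj.map f (irrelevant_le_map_of_surjective f hf)) =
      {p : Proj 𝒜 | RingHom.ker f ≤ p.asHomogeneousIdeal.toIdeal} := by
  ext p
  constructor
  · rintro ⟨q, rfl⟩ x hx
    change f x ∈ q.asHomogeneousIdeal.toIdeal
    rw [(RingHom.mem_ker (f := f)).1 hx]
    exact zero_mem _
  · intro hp
    have hp' : RingHom.ker f ≤ p.asHomogeneousIdeal.toIdeal := hp
    have hcomap : (p.asHomogeneousIdeal.toIdeal.map f).comap f = p.asHomogeneousIdeal.toIdeal := by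
      rw [Ideal.comap_map_of_surjective' f hf, sup_eq_left.2 hp]
    have hprime := p.isPrime
    refine ⟨⟨p.asHomogeneousIdeal.map f, Ideal.map_isPrime_of_surjective hf hp', ?_⟩, ?_⟩
    · intro h
      refine p.not_irrelevant_le ?_
      rw [irrelevant_le]
      intro i hi x hx
      have : f x ∈ p.asHomogeneousIdeal.toIdeal.map f :=
        h (mem_irrelevant_of_mem ℬ hi (map_mem f hx))
      rw [← Ideal.mem_comap, hcomap] at this
      exact this
    · refine ProjectiveSpectrum.ext (HomogeneousIdeal.ext ?_)
      exact hcomap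

theorem localRingHom_surjective (hf : Function.Surjective f) (I : Ideal A) [I.IsPrime]
    (J : Ideal B) [J.IsPrime] (hIJ : I = J.comap f) :
    Function.Surjective (localRingHom f I J hIJ) := by
  intro y
  obtain ⟨⟨i, b, s, hs⟩, rfl⟩ := y.mk_surjective
  obtain ⟨a, ha, hab⟩ := exists_homogeneous_preimage f hf b.2
  obtain ⟨t, ht, hts⟩ := exists_homogeneous_preimage f hf s.2
  have htI : t ∈ I.primeCompl := by
    intro h
    rw [hIJ] at h
    exact hs (hts ▸ h)
  refine ⟨HomogeneousLocalization.mk ⟨i, ⟨a, ha⟩, ⟨t, ht⟩, htI⟩, ?_⟩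
  ext
  simp [hab, hts]

/-- A surjective graded homomorphism induces a closed immersion: homogeneous elements lift to
homogeneous elements, so the maps of homogeneous localizations, which are the stalks, are
surjective. -/
theorem isClosedImmersion_projMap_of_surjective :
    IsClosedImmersion (Proj.map f (irrelevant_le_map_of_surjective f hf)) where
  stalkMap_surjective p := by
    have h := Proj.localRingHom_comp_stalkIso f (irrelevant_le_map_of_surjective f hf) p
    change Function.Surjective
      ((Proj.sheafedSpaceMap f (irrelevant_le_map_of_surjective f hf)).hom.stalkMap p)
    rw [← h]
    have hp := p.isPrime
    have hpr := (ProjectiveSpectrum.comap f (irrelevant_le_map_of_surjective f hf) p).isPrime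
    have h1 := (Proj.stalkIso 𝒜 (ProjectiveSpectrum.comap f
      (irrelevant_le_map_of_surjective f hf) p)).commRingCatIsoToRingEquiv.surjective
    have h2 := (Proj.stalkIso ℬ p).symm.commRingCatIsoToRingEquiv.surjective
    exact (h2.comp (localRingHom_surjective f hf (ProjectiveSpectrum.comap f
      (irrelevant_le_map_of_surjective f hf) p).asHomogeneousIdeal.toIdeal _ rfl)).comp h1
  isClosedEmbedding := by
    refine ⟨⟨⟨?_⟩, ?_⟩, ?_⟩
    · refine TopologicalSpace.ext_isClosed fun Z => ?_
      rw [isClosed_induced_iff]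
      constructor
      · intro hZ
        obtain ⟨s, rfl⟩ := (ProjectiveSpectrum.isClosed_iff_zeroLocus ℬ Z).1 hZ
        refine ⟨ProjectiveSpectrum.zeroLocus 𝒜 (f ⁻¹' s),
          ProjectiveSpectrum.isClosed_zeroLocus 𝒜 _, ?_⟩
        ext p
        change f ⁻¹' s ⊆ f ⁻¹' (p.asHomogeneousIdeal.toIdeal : Set B) ↔
          s ⊆ p.asHomogeneousIdeal.toIdeal
        exact hf.preimage_subset_preimage_iff
      · rintro ⟨Z, hZ, rfl⟩
        exact hZ.preimage (Proj.map f (irrelevant_le_map_of_surjective f hf)).continuous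
    · intro p q hpq
      refine ProjectiveSpectrum.ext (HomogeneousIdeal.ext ?_)
      have h : p.asHomogeneousIdeal.toIdeal.comap f = q.asHomogeneousIdeal.toIdeal.comap f :=
        congrArg (fun r : Proj 𝒜 => r.asHomogeneousIdeal.toIdeal) hpq
      exact Ideal.comap_injective_of_surjective f hf h
    · rw [range_projMap_of_surjective f hf]
      exact ProjectiveSpectrum.isClosed_zeroLocus 𝒜 _

end ProjMap

/-! ### `Proj` of reduced rings and of domains -/

section ProjProperties

open HomogeneousIdeal HomogeneousLocalization Graded

variable {A : Type v} [CommRing A] {σ : Type v} [SetLike σ A] [AddSubgroupClass σ A] (𝒜 : ℕ → σ)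
  [GradedRing 𝒜]

instance homogeneousLocalization_isReduced [_root_.IsReduced A] (W : Submonoid A) :
    _root_.IsReduced (HomogeneousLocalization 𝒜 W) :=
  have : _root_.IsReduced (Localization W) := inferInstance
  isReduced_of_injective (algebraMap (HomogeneousLocalization 𝒜 W) (Localization W))
    (val_injective W)

theorem isReduced_proj [_root_.IsReduced A] : AlgebraicGeometry.IsReduced (Proj 𝒜) := by
  have : ∀ i, AlgebraicGeometry.IsReduced ((Proj.affineOpenCover 𝒜).openCover.X i) := fun i =>
    (affine_isReduced_iff _).2
      (homogeneousLocalization_isReduced 𝒜 (Submonoid.powers (i.2 : A)))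
  exact AlgebraicGeometry.IsReduced.of_openCover _ (Proj.affineOpenCover 𝒜).openCover

/-- The generic point of `Proj` of a graded domain, given by the zero ideal. A non-zero element of
positive degree is needed for this ideal to be relevant. -/
def projGenericPoint [IsDomain A] {i : ℕ} (hi : 0 < i) {x : A} (hx : x ∈ 𝒜 i) (hx0 : x ≠ 0) :
    Proj 𝒜 where
  asHomogeneousIdeal := ⊥
  isPrime := Ideal.isPrime_bot
  not_irrelevant_le h := hx0 (h (mem_irrelevant_of_mem 𝒜 hi hx))

theorem isIntegral_proj [IsDomain A] {i : ℕ} (hi : 0 < i) {x : A} (hx : x ∈ 𝒜 i) (hx0 : x ≠ 0) :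
    IsIntegral (Proj 𝒜) := by
  have := isReduced_proj 𝒜
  have h : closure {projGenericPoint 𝒜 hi hx hx0} = Set.univ := by
    refine Set.eq_univ_of_forall fun p => ?_
    refine (ProjectiveSpectrum.le_iff_mem_closure 𝒜 (projGenericPoint 𝒜 hi hx hx0) p).1 ?_
    exact bot_le (a := p.asHomogeneousIdeal)
  have : IrreducibleSpace (Proj 𝒜) := by
    rw [irreducibleSpace_def, Set.top_eq_univ, ← h]
    exact isIrreducible_singleton.closure
  exact isIntegral_of_irreducibleSpace_of_isReduced _

end ProjProperties

/-! ### Morphisms of `Proj`s over a field -/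

section ProjStr

variable {K : Type v} [Field K] {A B : Type v} [CommRing A] [CommRing B] [Algebra K A] [Algebra K B]
  {𝒜 : ℕ → Submodule K A} {ℬ : ℕ → Submodule K B} [GradedAlgebra 𝒜] [GradedAlgebra ℬ]

open HomogeneousIdeal HomogeneousLocalization Graded

theorem awayι_projMap_projStr (f : 𝒜 →+*ᵍ ℬ)
    (hK : ∀ c : K, f (algebraMap K A c) = algebraMap K B c) (hf : ℬ₊ ≤ 𝒜₊.map f) {i : ℕ}
    (hi : 0 < i) (s : A) (hs : s ∈ 𝒜 i) :
    Proj.awayι ℬ (f s) (f.2 hs) hi ≫ Proj.map f hf ≫ projStr K 𝒜 =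
      Proj.awayι ℬ (f s) (f.2 hs) hi ≫ projStr K ℬ := by
  have h1 := Proj.awayι_comp_map f hf hi s hs
  have h2 := Proj.awayι_toSpecZero 𝒜 s hs hi
  have h3 := Proj.awayι_toSpecZero ℬ (f s) (f.2 hs) hi
  rw [← Category.assoc, h1, projStr, projStr, Category.assoc, reassoc_of% h2, reassoc_of% h3,
    ← Spec.map_comp, ← Spec.map_comp, ← Spec.map_comp,
    ← CommRingCat.ofHom_comp, ← CommRingCat.ofHom_comp, ← CommRingCat.ofHom_comp]
  congr 2
  ext c
  change (Away.map f s (HomogeneousLocalization.mk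
    ⟨0, algebraMap K (𝒜 0) c, 1, Submonoid.one_mem _⟩)).val = HomogeneousLocalization.val
    (HomogeneousLocalization.mk ⟨0, algebraMap K (ℬ 0) c, 1, Submonoid.one_mem _⟩)
  rw [Away.map, HomogeneousLocalization.map_mk, HomogeneousLocalization.val_mk,
    HomogeneousLocalization.val_mk]
  simp [hK]

/-- The morphism of `Proj`s induced by a graded homomorphism of `K`-algebras is a morphism
over `K`. -/
theorem projMap_projStr (f : 𝒜 →+*ᵍ ℬ) (hK : ∀ c : K, f (algebraMap K A c) = algebraMap K B c)
    (hf : ℬ₊ ≤ 𝒜₊.map f) : Proj.map f hf ≫ projStr K 𝒜 = projStr K ℬ :=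
  (Proj.mapAffineOpenCover f hf).openCover.hom_ext _ _ fun s =>
    awayι_projMap_projStr f hK hf s.1.2 s.2.1 s.2.2

/-- A graded isomorphism of algebras as a homomorphism of graded rings. -/
def gradedHomOfAlgEquiv (e : A ≃ₐ[K] B) (he : ∀ i, (𝒜 i).map e.toLinearMap = ℬ i) : 𝒜 →+*ᵍ ℬ where
  toRingHom := e.toRingEquiv.toRingHom
  map_mem {i x} hx := by
    rw [← he i]
    exact ⟨x, hx, rfl⟩

/-- A graded isomorphism of algebras induces an isomorphism over `K` of the `Proj`s. -/
theorem exists_projIso (e : A ≃ₐ[K] B) (he : ∀ i, (𝒜 i).map e.toLinearMap = ℬ i) :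
    ∃ Φ : Proj 𝒜 ≅ Proj ℬ, Φ.hom ≫ projStr K ℬ = projStr K 𝒜 := by
  have he' : ∀ i, (ℬ i).map e.symm.toLinearMap = 𝒜 i := by
    intro i
    rw [← he i, ← Submodule.map_comp]
    convert Submodule.map_id _
    ext x
    simp
  let f : 𝒜 →+*ᵍ ℬ := gradedHomOfAlgEquiv e he
  let g : ℬ →+*ᵍ 𝒜 := gradedHomOfAlgEquiv e.symm he'
  have hfg : g.comp f = GradedRingHom.id 𝒜 := by
    ext x
    exact e.symm_apply_apply x
  have hgf : f.comp g = GradedRingHom.id ℬ := by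
    ext x
    exact e.apply_symm_apply x
  have hf := irrelevant_le_map_of_surjective f e.surjective
  have hg := irrelevant_le_map_of_surjective g e.symm.surjective
  refine ⟨⟨Proj.map g hg, Proj.map f hf, ?_, ?_⟩, projMap_projStr g e.symm.commutes hg⟩
  · rw [← Proj.map_comp]
    simp_rw [hfg]
    exact Proj.map_id
  · rw [← Proj.map_comp]
    simp_rw [hgf]
    exact Proj.map_id

end ProjStr

/-! ### The dimension of a projective toric variety -/

section ToricDimension

open AddMonoidAlgebra

instance isDomain_monoidAlgebra {K : Type*} [Field K] {d : ℕ} (M : AddSubmonoid (ℕ × (Fin d → ℤ))) :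
    IsDomain (AddMonoidAlgebra K M) := by
  have : TwoUniqueSums M :=
    TwoUniqueSums.of_injective_addHom (M.subtype : M →ₙ+ ℕ × (Fin d → ℤ))
      (fun a b h => Subtype.ext h) inferInstance
  exact NoZeroDivisors.to_isDomain _

variable {K : Type v} [Field K] {d : ℕ}

/-- A Laurent polynomial ring is algebraic over a subring containing, up to a common factor,
numerator and denominator of a power of every Laurent monomial. -/
theorem isAlgebraic_laurent {G : Type} [AddCommGroup G] {R : Type v} [CommRing R] [IsDomain R]
    [Algebra K R] [Algebra R (AddMonoidAlgebra K G)] [IsScalarTower K R (AddMonoidAlgebra K G)]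
    (h : ∀ z : G, ∃ n : ℕ, 0 < n ∧ ∃ a b : R, b ≠ 0 ∧
      single (n • z) 1 * algebraMap R (AddMonoidAlgebra K G) b = algebraMap R _ a) :
    Algebra.IsAlgebraic R (AddMonoidAlgebra K G) := by
  have hsingle : ∀ z : G, IsAlgebraic R (single z (1 : K)) := by
    intro z
    obtain ⟨n, hn, a, b, hb, hab⟩ := h z
    refine ⟨Polynomial.C b * Polynomial.X ^ n - Polynomial.C a, ?_, ?_⟩
    · intro h0
      have := congrArg (fun p => Polynomial.coeff p n) h0
      simp [Polynomial.coeff_C, hn.ne', hb] at this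
    · simp only [map_sub, map_mul, Polynomial.aeval_C, map_pow, Polynomial.aeval_X]
      rw [single_pow, one_pow, mul_comm, hab, sub_self]
  refine ⟨fun x => ?_⟩
  induction x using AddMonoidAlgebra.induction_on with
  | of z => exact hsingle z
  | add x y hx hy => exact hx.add hy
  | smul c x hx =>
    rw [← algebraMap_smul R c x, Algebra.smul_def]
    exact isAlgebraic_algebraMap _ |>.mul hx

theorem trdeg_laurent (K : Type v) [Field K] (d : ℕ) :
    Algebra.trdeg K (AddMonoidAlgebra K (Fin d → ℤ)) = d := by
  let ι : (Fin d →₀ ℕ) →+ (Fin d → ℤ) :=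
    { toFun := fun a i => a i
      map_zero' := by ext; simp
      map_add' := fun a b => by ext; simp }
  have hι : Function.Injective ι := fun a b hab => by
    ext i
    exact Int.ofNat_injective (congrFun hab i)
  let φ : MvPolynomial (Fin d) K →ₐ[K] AddMonoidAlgebra K (Fin d → ℤ) := mapDomainAlgHom K K ι
  let _ : Algebra (MvPolynomial (Fin d) K) (AddMonoidAlgebra K (Fin d → ℤ)) := φ.toRingHom.toAlgebra
  have : IsScalarTower K (MvPolynomial (Fin d) K) (AddMonoidAlgebra K (Fin d → ℤ)) :=
    IsScalarTower.of_algebraMap_eq fun x => (φ.commutes x).symm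
  have : FaithfulSMul (MvPolynomial (Fin d) K) (AddMonoidAlgebra K (Fin d → ℤ)) :=
    (faithfulSMul_iff_algebraMap_injective _ _).2 (mapDomain_injective hι)
  have : Algebra.IsAlgebraic (MvPolynomial (Fin d) K) (AddMonoidAlgebra K (Fin d → ℤ)) := by
    refine isAlgebraic_laurent (K := K) fun z => ?_
    let p : Fin d →₀ ℕ := Finsupp.equivFunOnFinite.symm fun i => (z i).toNat
    let q : Fin d →₀ ℕ := Finsupp.equivFunOnFinite.symm fun i => (-z i).toNat
    refine ⟨1, one_pos, single p 1, single q 1, ?_, ?_⟩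
    · exact fun h => one_ne_zero (AddMonoidAlgebra.single_eq_zero.1 h)
    · change single _ _ * mapDomain ι (single q 1) = mapDomain ι (single p 1)
      rw [mapDomain_single, mapDomain_single, single_mul_single, one_smul, mul_one]
      congr 1
      ext i
      change z i + ((-z i).toNat : ℤ) = ((z i).toNat : ℤ)
      omega
  rw [← trdeg_eq_of_isAlgebraic K (MvPolynomial (Fin d) K), MvPolynomial.trdeg_of_isDomain]
  simp

variable (M : AddSubmonoid (ℕ × (Fin d → ℤ)))

/-- Setting the degree variable to `1`. -/
noncomputable def dehomogenize : AddMonoidAlgebra K M →ₐ[K] AddMonoidAlgebra K (Fin d → ℤ) :=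
  mapDomainAlgHom K K ((AddMonoidHom.snd ℕ (Fin d → ℤ)).comp M.subtype)

theorem dehomogenize_single (u : M) (c : K) :
    dehomogenize M (single u c) = single u.1.2 c := mapDomain_single

/-- Dehomogenization is injective on each graded piece. -/
theorem dehomogenize_eq_zero {i : ℕ} {x : AddMonoidAlgebra K M} (hx : x ∈ monoidGrade K M i)
    (h : dehomogenize M x = 0) : x = 0 := by
  have hinj : Set.InjOn (fun u : M => u.1.2) {u | deg M u = i} := by
    intro u hu w hw huw
    exact Subtype.ext (Prod.ext (hu.trans hw.symm) huw)
  refine coeff_injective (Finsupp.mapDomain_injOn _ hinj hx (by simp) ?_)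
  rw [coeff_zero, Finsupp.mapDomain_zero]
  exact congrArg coeff h

open HomogeneousLocalization

/-- The ring of functions on the chart of `Proj K[M]` where the monomial of `u` does not vanish. -/
abbrev Chart (K : Type v) [Field K] {M : AddSubmonoid (ℕ × (Fin d → ℤ))} (u : M) : Type v :=
  Away (monoidGrade K M) (single u (1 : K))

variable {M} (u : M)

instance isScalarTower_gradeZero :
    IsScalarTower K (monoidGrade K M 0) (AddMonoidAlgebra K M) :=
  IsScalarTower.of_algebraMap_eq (R := K) (S := monoidGrade K M 0) (A := AddMonoidAlgebra K M)
    fun _ => rfl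

theorem chart_algebraMap_val (c : K) :
    (algebraMap (monoidGrade K M 0) (Chart K u) (algebraMap K _ c)).val =
      algebraMap (AddMonoidAlgebra K M) _ (algebraMap K _ c) := by
  rw [IsScalarTower.algebraMap_apply K (monoidGrade K M 0) (AddMonoidAlgebra K M)]
  rfl

noncomputable instance chartAlgebra : Algebra K (Chart K u) where
  toSMul := inferInstance
  algebraMap := (algebraMap (monoidGrade K M 0) (Chart K u)).comp
    (algebraMap K (monoidGrade K M 0))
  commutes' _ _ := mul_comm _ _
  smul_def' c x := by
    ext
    refine (val_smul _ c x).trans ?_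
    rw [val_mul, RingHom.comp_apply, chart_algebraMap_val, Algebra.smul_def,
      IsScalarTower.algebraMap_apply K (AddMonoidAlgebra K M) (Localization _)]

instance : IsScalarTower K (monoidGrade K M 0) (Chart K u) :=
  IsScalarTower.of_algebraMap_eq (R := K) (S := monoidGrade K M 0) (A := Chart K u) fun _ => rfl

theorem isUnit_dehomogenize_single : IsUnit ((dehomogenize M).toRingHom (single u (1 : K))) := by
  refine IsUnit.of_mul_eq_one (single (-u.1.2) 1) ?_
  change dehomogenize M (single u 1) * _ = 1
  rw [dehomogenize_single, single_mul_single, add_neg_cancel, one_mul, AddMonoidAlgebra.one_def]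

/-- The embedding of a chart in the ring of Laurent polynomials. -/
noncomputable def chartMap : Chart K u →+* AddMonoidAlgebra K (Fin d → ℤ) :=
  (Localization.awayLift (dehomogenize M).toRingHom (single u (1 : K))
    (isUnit_dehomogenize_single u)).comp
      (algebraMap (Chart K u) (Localization.Away (single u (1 : K))))

theorem single_mem_monoidGrade (w : M) (c : K) : single w c ∈ monoidGrade K M w.1.1 :=
  single_mem_gradeBy (deg M) w c

/-- The element `x / (χ^u)^n` of the chart is taken to the dehomogenization of `x`, divided by a
Laurent monomial. -/
theorem chartMap_mk (n : ℕ) (x : AddMonoidAlgebra K M) (hx : x ∈ monoidGrade K M (n • u.1.1)) :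
    single (n • u.1.2) 1 * chartMap u (Away.mk _ (single_mem_monoidGrade u 1) n x hx) =
      dehomogenize M x := by
  have h := IsLocalization.mk'_spec' (Localization.Away (single u (1 : K))) x
    (⟨single u (1 : K) ^ n, n, rfl⟩ : Submonoid.powers (single u (1 : K)))
  have h' := congrArg (Localization.awayLift (dehomogenize M).toRingHom (single u (1 : K))
    (isUnit_dehomogenize_single u)) h
  rw [map_mul, Localization.awayLift, IsLocalization.Away.lift_eq,
    IsLocalization.Away.lift_eq] at h'
  have h2 : (dehomogenize M).toRingHom (single u (1 : K) ^ n) = single (n • u.1.2) 1 := by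
    change dehomogenize M _ = _
    rw [map_pow, dehomogenize_single, single_pow, one_pow]
  rw [h2] at h'
  rw [← Localization.mk_eq_mk'] at h'
  exact h'

theorem chartMap_injective : Function.Injective (chartMap (K := K) u) := by
  rw [injective_iff_map_eq_zero]
  intro y hy
  obtain ⟨n, x, hx, rfl⟩ := Away.mk_surjective _ (single_mem_monoidGrade u (1 : K)) y
  have h := chartMap_mk u n x hx
  rw [hy, mul_zero] at h
  obtain rfl := dehomogenize_eq_zero M hx h.symm
  ext
  rw [Away.val_mk, Localization.mk_zero, val_zero]

instance : IsDomain (Chart K u) := (chartMap_injective u).isDomain _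

theorem chartMap_algebraMap (c : K) :
    chartMap u (algebraMap K (Chart K u) c) = algebraMap K _ c := by
  have h : algebraMap K (Chart K u) c = Away.mk _ (single_mem_monoidGrade u (1 : K)) 0
      (algebraMap K _ c) (by rw [zero_smul]; exact SetLike.algebraMap_mem_graded _ c) := by
    ext
    rw [Away.val_mk]
    refine (chart_algebraMap_val u c).trans ?_
    rw [← Localization.mk_one_eq_algebraMap]
    congr 1
  have h2 := chartMap_mk u 0 (algebraMap K (AddMonoidAlgebra K M) c)
    (by rw [zero_smul]; exact SetLike.algebraMap_mem_graded _ c)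
  rw [← h, zero_smul, ← AddMonoidAlgebra.one_def, one_mul, AlgHom.commutes] at h2
  exact h2

/-- Every vector of degree zero is, up to a positive multiple, a difference of two elements of `M`
of the same degree. -/
def HasFullRank (M : AddSubmonoid (ℕ × (Fin d → ℤ))) : Prop :=
  ∀ z : Fin d → ℤ, ∃ n : ℕ, 0 < n ∧ ∃ a ∈ M, ∃ b ∈ M, a.1 = b.1 ∧ n • z = a.2 - b.2

/-- The Laurent polynomial ring is algebraic over the ring of the chart: a multiple of every `z` is
the difference of two exponents of Laurent monomials in the chart. -/
theorem trdeg_chart (hM : HasFullRank M) (hu : 0 < u.1.1) :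
    Algebra.trdeg K (Chart K u) = d := by
  let _ : Algebra (Chart K u) (AddMonoidAlgebra K (Fin d → ℤ)) := (chartMap u).toAlgebra
  have : IsScalarTower K (Chart K u) (AddMonoidAlgebra K (Fin d → ℤ)) :=
    IsScalarTower.of_algebraMap_eq (R := K) (S := Chart K u)
      (A := AddMonoidAlgebra K (Fin d → ℤ)) fun x => (chartMap_algebraMap u x).symm
  have : FaithfulSMul (Chart K u) (AddMonoidAlgebra K (Fin d → ℤ)) :=
    (faithfulSMul_iff_algebraMap_injective _ _).2 (chartMap_injective u)
  have : Algebra.IsAlgebraic (Chart K u) (AddMonoidAlgebra K (Fin d → ℤ)) := by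
    refine isAlgebraic_laurent (K := K) fun z => ?_
    obtain ⟨n, hn, a, ha, b, hb, hab, hz⟩ := hM z
    have hdeg : ∀ c : M, single (u.1.1 • c) (1 : K) ∈ monoidGrade K M (c.1.1 • u.1.1) := by
      intro c
      have := single_mem_monoidGrade (u.1.1 • c) (1 : K)
      rwa [show (u.1.1 • c).1.1 = c.1.1 • u.1.1 by simp [mul_comm]] at this
    -- the Laurent monomial of `deg u • c - deg c • u`
    let m : M → Chart K u := fun c => Away.mk _ (single_mem_monoidGrade u 1) c.1.1 _ (hdeg c)
    have hm : ∀ c, single (c.1.1 • u.1.2) 1 * chartMap u (m c) = single (u.1.1 • c.1.2) 1 := by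
      intro c
      rw [chartMap_mk, dehomogenize_single]
      simp
    have hm' : ∀ c, chartMap u (m c) = single (u.1.1 • c.1.2 - c.1.1 • u.1.2) 1 := by
      intro c
      have := congrArg (fun y => single (-(c.1.1 • u.1.2)) (1 : K) * y) (hm c)
      simp only [← mul_assoc, single_mul_single, neg_add_cancel, one_mul,
        ← AddMonoidAlgebra.one_def] at this
      rw [this, neg_add_eq_sub]
    refine ⟨u.1.1 * n, Nat.mul_pos hu hn, m ⟨a, ha⟩, m ⟨b, hb⟩, ?_, ?_⟩
    · intro h
      have := hm' ⟨b, hb⟩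
      rw [h, map_zero] at this
      exact one_ne_zero (single_eq_zero.1 this.symm)
    · change _ * chartMap u _ = chartMap u _
      rw [hm', hm', single_mul_single, one_mul, mul_smul, hz, hab, smul_sub]
      congr 1
      abel
  rw [trdeg_eq_of_isAlgebraic K (Chart K u) (AddMonoidAlgebra K (Fin d → ℤ)), trdeg_laurent]

/-- If only `0` has degree `0`, then the degree `0` part of `K[M]` is `K`, and the charts are
finitely generated over it. -/
theorem finiteType_chart (hfg : M.FG) (h0 : ∀ w ∈ M, w.1 = 0 → w = 0) :
    Algebra.FiniteType K (Chart K u) := by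
  have : AddMonoid.FG M := (AddMonoid.fg_iff_addSubmonoid_fg M).2 hfg
  have h1 : Algebra.FiniteType K (AddMonoidAlgebra K M) := finiteType_of_fg K M
  have h2 : Algebra.FiniteType (monoidGrade K M 0) (AddMonoidAlgebra K M) :=
    Algebra.FiniteType.of_restrictScalars_finiteType K _ _
  have h3 : Algebra.FiniteType K (monoidGrade K M 0) := by
    refine Algebra.FiniteType.of_surjective (Algebra.ofId K (monoidGrade K M 0)) fun x => ?_
    refine ⟨x.1.coeff 0, ?_⟩
    refine Subtype.ext (coeff_injective (Finsupp.ext fun w => ?_))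
    change (algebraMap K (AddMonoidAlgebra K M) (x.1.coeff 0)).coeff w = x.1.coeff w
    rw [coe_algebraMap]
    change (Finsupp.single 0 (x.1.coeff 0)) w = _
    rcases eq_or_ne w 0 with rfl | hw
    · simp
    · rw [Finsupp.single_eq_of_ne hw, eq_comm]
      by_contra hxw
      have hdeg : deg M w = 0 :=
        (mem_gradeBy_iff K _ _ _).1 x.2 (Finset.mem_coe.2 (Finsupp.mem_support_iff.2 hxw))
      exact hw (Subtype.ext (h0 w.1 w.2 hdeg))
  exact h3.trans (Away.finiteType _ _ (single_mem_monoidGrade u 1))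

/-- The projective toric variety of a finitely generated monoid of full rank has dimension `d`: the
charts of the monomials of positive degree cover it, and each has dimension `d` because its ring has
transcendence degree `d`. -/
theorem topologicalKrullDim_proj_monoidAlgebra (K : Type v) [Field K] (hfg : M.FG)
    (h0 : ∀ w ∈ M, w.1 = 0 → w = 0) (hM : HasFullRank M) (hpos : ∃ w ∈ M, 0 < w.1) :
    topologicalKrullDim (Proj (monoidGrade K M)) = d := by
  have : Nonempty {w : M // 0 < w.1.1} := by
    obtain ⟨w, hw, hw0⟩ := hpos
    exact ⟨⟨⟨w, hw⟩, hw0⟩⟩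
  let 𝒰 := Proj.affineOpenCoverOfIrrelevantLESpan (monoidGrade K M)
    (fun w : {w : M // 0 < w.1.1} => single w.1 (1 : K)) (fun w => single_mem_monoidGrade w.1 1)
    (fun w => w.2) (by
      rw [HomogeneousIdeal.toIdeal_irrelevant_le]
      intro i hi x hx
      rw [← sum_coeff_single x]
      refine sum_mem fun w hw => ?_
      have hw' : deg M w = i := (mem_gradeBy_iff K _ _ _).1 hx (Finset.mem_coe.2 hw)
      have : single w (x.coeff w) = single 0 (x.coeff w) * single w (1 : K) := by
        rw [single_mul_single, zero_add, mul_one]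
      rw [this]
      exact Ideal.mul_mem_left _ _ (Ideal.subset_span ⟨⟨w, hi.trans_eq hw'.symm⟩, rfl⟩))
  refine topologicalKrullDim_eq_of_isOpenEmbedding (ι := {w : M // 0 < w.1.1})
    (fun w => 𝒰.f w) (fun w => ?_) (fun x => ?_) fun w => ?_
  · exact (Proj.awayι (monoidGrade K M) (single w.1 (1 : K)) (single_mem_monoidGrade w.1 1)
      w.2).isOpenEmbedding
  · exact ⟨_, 𝒰.covers x⟩
  · have := finiteType_chart (K := K) w.1 hfg h0
    change topologicalKrullDim (PrimeSpectrum (Chart K w.1)) = d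
    rw [PrimeSpectrum.topologicalKrullDim_eq_ringKrullDim]
    exact ringKrullDim_eq_trdeg K (trdeg_chart w.1 hM w.2)

end ToricDimension

/-! ### Lexicographic inequalities -/

section Lex

variable {N : ℕ}

theorem toLex_smul_le_iff {c : ℝ} (hc : 0 < c) {a b : Fin N → ℝ} :
    toLex (c • a) ≤ toLex (c • b) ↔ toLex a ≤ toLex b := by
  have key : ∀ {c : ℝ}, 0 < c → ∀ {a b : Fin N → ℝ}, toLex a < toLex b →
      toLex (c • a) < toLex (c • b) := by
    rintro c hc a b ⟨i, hi, hlt⟩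
    exact ⟨i, fun j hj => congrArg (c * ·) (hi j hj), mul_lt_mul_of_pos_left hlt hc⟩
  rw [← not_lt, ← not_lt, not_iff_not]
  refine ⟨fun h => ?_, key hc⟩
  have := key (inv_pos.2 hc) h
  rwa [inv_smul_smul₀ hc.ne', inv_smul_smul₀ hc.ne'] at this

/-- The inclusion of `ℚ^N` in `ℝ^N`. -/
def ratVecCast (N : ℕ) : (Fin N → ℚ) →ₗ[ℚ] (Fin N → ℝ) where
  toFun a i := a i
  map_add' a b := by ext; simp
  map_smul' c a := by ext; simp [Rat.smul_def]

theorem ratVecCast_injective : Function.Injective (ratVecCast N) := fun a b h => by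
  ext i
  have : (a i : ℝ) = b i := congrFun h i
  exact_mod_cast this

theorem toValue_le_iff {a b : Fin N → ℚ} :
    toValue a ≤ toValue b ↔ toLex (ratVecCast N a) ≤ toLex (ratVecCast N b) := by
  have key : ∀ {a b : Fin N → ℚ}, toValue a < toValue b →
      toLex (ratVecCast N a) < toLex (ratVecCast N b) := by
    rintro a b ⟨i, hi, hlt⟩
    exact ⟨i, fun j hj => congrArg (Rat.cast : ℚ → ℝ) (hi j hj), Rat.cast_lt.2 hlt⟩
  constructor
  · intro h
    rcases h.lt_or_eq with h | h
    · exact (key h).le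
    · have : a = b := h
      rw [this]
  · intro h
    by_contra h'
    exact absurd h (key (not_le.1 h')).not_ge

end Lex

/-! ### Cones over convex sets -/

section Cone

variable {d : ℕ}

theorem smul_mem_cone {D : Set (Fin d → ℝ)} {r : ℝ} (hr : 0 ≤ r) {x : Fin d → ℝ} (hx : x ∈ D) :
    r • ((1 : ℝ), x) ∈ cone D :=
  (cone D).smul_mem hr (PointedCone.subset_hull ⟨x, hx, rfl⟩)

/-- The cone generated by `{1} × D` for convex `D` consists of the multiples of the `(1, x)`,
`x ∈ D`. -/
theorem exists_of_mem_cone {D : Set (Fin d → ℝ)} (hD : Convex ℝ D) (hne : D.Nonempty)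
    {z : ℝ × (Fin d → ℝ)} (hz : z ∈ cone D) : ∃ r : ℝ, 0 ≤ r ∧ ∃ x ∈ D, z = r • ((1 : ℝ), x) := by
  induction hz using Submodule.span_induction with
  | mem z h =>
    obtain ⟨x, hx, rfl⟩ := h
    exact ⟨1, zero_le_one, x, hx, (one_smul _ _).symm⟩
  | zero =>
    obtain ⟨x, hx⟩ := hne
    exact ⟨0, le_rfl, x, hx, (zero_smul _ _).symm⟩
  | add z w _ _ hz hw =>
    obtain ⟨r, hr, x, hx, rfl⟩ := hz
    obtain ⟨s, hs, y, hy, rfl⟩ := hw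
    rcases hr.eq_or_lt with rfl | hr'
    · exact ⟨s, hs, y, hy, by rw [zero_smul, zero_add]⟩
    have hrs : 0 < r + s := by linarith
    refine ⟨r + s, hrs.le, (r / (r + s)) • x + (s / (r + s)) • y,
      hD hx hy (by positivity) (by positivity) (by field_simp), ?_⟩
    ext i
    · simp
    · simp only [Prod.snd_add, Prod.smul_snd, Pi.add_apply, Pi.smul_apply, smul_eq_mul]
      field_simp
  | smul c z _ hz =>
    obtain ⟨r, hr, x, hx, rfl⟩ := hz
    exact ⟨c.1 * r, mul_nonneg c.2 hr, x, hx, (mul_smul c.1 r _).symm⟩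

theorem smul_mem_cone_iff {D : Set (Fin d → ℝ)} (hD : Convex ℝ D) (hne : D.Nonempty) {r : ℝ}
    (hr : 0 < r) {x : Fin d → ℝ} : r • ((1 : ℝ), x) ∈ cone D ↔ x ∈ D := by
  refine ⟨fun h => ?_, smul_mem_cone hr.le⟩
  obtain ⟨s, -, y, hy, hxy⟩ := exists_of_mem_cone hD hne h
  have h1 : r = s := by simpa using congrArg Prod.fst hxy
  have h2 : r • x = s • y := congrArg Prod.snd hxy
  rw [← h1] at h2
  rwa [smul_right_injective _ hr.ne' h2]

namespace MarkedPolytope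

variable (P : MarkedPolytope d)

theorem polytope_convex : Convex ℝ P.polytope := convex_convexHull _ _

theorem polytope_isClosed : IsClosed P.polytope :=
  ((P.A.finite_toSet.image _).isCompact_convexHull ℝ).isClosed

theorem mem_polytope {χ : Fin d → ℤ} (hχ : χ ∈ P.A) : toReal χ ∈ P.polytope :=
  subset_convexHull ℝ _ ⟨χ, hχ, rfl⟩

theorem polytope_nonempty : P.polytope.Nonempty :=
  let ⟨_, hχ⟩ := P.nonempty
  ⟨_, P.mem_polytope hχ⟩

theorem interior_polytope_nonempty : (interior P.polytope).Nonempty :=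
  interior_convexHull_nonempty_iff_affineSpan_eq_top.2 P.spans

theorem ext_A {P Q : MarkedPolytope d} (h : P.A = Q.A) : P = Q := by
  cases P; cases Q; cases h; rfl

/-- A rational linear form that vanishes on the marking extends to a real affine function that
vanishes on an affinely spanning set. -/
theorem span_latticeToRat :
    Submodule.span ℚ ((fun χ => latticeToRat (1, χ)) '' (P.A : Set (Fin d → ℤ))) = ⊤ := by
  by_contra hne
  obtain ⟨f, hf0, hf⟩ := Submodule.exists_le_ker_of_lt_top _ (lt_top_iff_ne_top.2 hne)
  refine hf0 ?_
  -- the real affine function with the coefficients of `f` vanishes on the marking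
  let c : Fin d → ℚ := fun i => f (0, Pi.single i 1)
  have hfc : ∀ r x, f (r, x) = r * f (1, 0) + ∑ i, x i * c i := by
    intro r x
    have h1 : ((r, x) : ℚ × (Fin d → ℚ)) = r • (1, 0) + ∑ i, x i • (0, Pi.single i 1) := by
      ext j
      · simp [Prod.fst_sum]
      · simp [Prod.snd_sum, Finset.sum_apply, Pi.single_apply]
    conv_lhs => rw [h1]
    simp only [map_add, map_sum, map_smul, smul_eq_mul, c]
  let F : (Fin d → ℝ) →ᵃ[ℝ] ℝ :=
    (∑ i, (c i : ℝ) • LinearMap.proj (R := ℝ) (φ := fun _ : Fin d => ℝ) i).toAffineMap +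
      AffineMap.const ℝ _ (f (1, 0) : ℝ)
  have hF : ∀ y, F y = ∑ i, (c i : ℝ) * y i + (f (1, 0) : ℝ) := by
    intro y
    simp [F]
  have hF0 : F = 0 := by
    refine AffineMap.ext_on P.spans ?_
    rintro _ ⟨χ, hχ, rfl⟩
    have h : f (latticeToRat (1, χ)) = 0 := hf (Submodule.subset_span ⟨χ, hχ, rfl⟩)
    have h2 := hfc (latticeToRat (1, χ)).1 (latticeToRat (1, χ)).2
    rw [Prod.mk.eta, h] at h2
    have h3 := congrArg (Rat.cast : ℚ → ℝ) h2
    rw [hF]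
    simp only [latticeToRat, AddMonoidHom.coe_mk, ZeroHom.coe_mk, Nat.cast_one, one_mul,
      Rat.cast_zero, Rat.cast_add, Rat.cast_sum, Rat.cast_mul, Rat.cast_intCast] at h3
    simp only [toReal, AffineMap.coe_zero, Pi.zero_apply]
    rw [h3, add_comm]
    congr 1
    exact Finset.sum_congr rfl fun i _ => mul_comm _ _
  have h0 : f (1, 0) = 0 := by
    have := hF 0
    rw [hF0] at this
    simpa using this.symm
  have hc : ∀ i, c i = 0 := by
    intro i
    have := hF (Pi.single i 1)
    rw [hF0] at this
    simpa [Pi.single_apply, h0] using this.symm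
  refine LinearMap.ext fun ⟨r, x⟩ => ?_
  rw [hfc, h0]
  simp [hc]

/-- A marked polytope has full dimension, so a linear map is determined by its values on the
marking. -/
theorem linearMap_ext {V : Type*} [AddCommGroup V] [Module ℚ V] {f g : ℚ × (Fin d → ℚ) →ₗ[ℚ] V}
    (h : ∀ χ ∈ P.A, f (latticeToRat (1, χ)) = g (latticeToRat (1, χ))) : f = g := by
  refine LinearMap.ext_on P.span_latticeToRat ?_
  rintro _ ⟨χ, hχ, rfl⟩
  exact h χ hχ

end MarkedPolytope

variable {N : ℕ} {P : MarkedPolytope d} {𝒬 : Subdivision P}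

theorem Subdivision.polytope_subset {Q : MarkedPolytope d} (hQ : Q ∈ 𝒬.cells) :
    Q.polytope ⊆ P.polytope := by
  rw [← 𝒬.covers]
  exact Set.subset_biUnion_of_mem (u := fun Q : MarkedPolytope d => Q.polytope) hQ

theorem Subdivision.exists_mem_polytope {x : Fin d → ℝ} (hx : x ∈ P.polytope) :
    ∃ Q ∈ 𝒬.cells, x ∈ Q.polytope := by
  rw [← 𝒬.covers] at hx
  simpa using hx

theorem Subdivision.exists_mem_cone {z : ℝ × (Fin d → ℝ)} (hz : z ∈ cone P.polytope) :
    ∃ Q ∈ 𝒬.cells, z ∈ cone Q.polytope := by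
  obtain ⟨r, hr, x, hx, rfl⟩ := exists_of_mem_cone P.polytope_convex P.polytope_nonempty hz
  obtain ⟨Q, hQ, hxQ⟩ := 𝒬.exists_mem_polytope hx
  exact ⟨Q, hQ, smul_mem_cone hr hxQ⟩

end Cone

/-! ### Piecewise linear maps and their domains of linearity -/

section AssociatedMap

variable {d N : ℕ} {P : MarkedPolytope d} {𝒬 : Subdivision P} {Ψ : Matrix (Fin N) P.A ℝ}
  {g : ℝ × (Fin d → ℝ) → Fin N → ℝ} {φ : ℝ × (Fin d → ℝ) →ₗ[ℝ] (Fin N → ℝ)}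
  {Q : MarkedPolytope d}

theorem IsAssociatedMap.map_smul (hg : IsAssociatedMap 𝒬 Ψ g) {x : Fin d → ℝ}
    (hx : x ∈ P.polytope) {r : ℝ} (hr : 0 ≤ r) : g (r • ((1 : ℝ), x)) = r • g (1, x) := by
  obtain ⟨Q, hQ, hxQ⟩ := 𝒬.exists_mem_polytope hx
  obtain ⟨φ, hφ⟩ := hg.piecewiseLinear Q hQ
  have h1 := hφ (smul_mem_cone zero_le_one hxQ)
  rw [one_smul] at h1
  rw [hφ (smul_mem_cone hr hxQ), h1, LinearMap.map_smul]

theorem mem_cone_one {D : Set (Fin d → ℝ)} {x : Fin d → ℝ} (hx : x ∈ D) : ((1 : ℝ), x) ∈ cone D :=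
  PointedCone.subset_hull ⟨x, hx, rfl⟩

/-- A concave map lies below each of its linear pieces: move from an interior point of the cell
towards the given point. -/
theorem IsAssociatedMap.le_cellMap (hg : IsAssociatedMap 𝒬 Ψ g) (hQ : Q ∈ 𝒬.cells)
    (hφ : Set.EqOn g φ (cone Q.polytope)) {x : Fin d → ℝ} (hx : x ∈ P.polytope) :
    toLex (g (1, x)) ≤ toLex (φ (1, x)) := by
  obtain ⟨q, hq⟩ := Q.interior_polytope_nonempty
  have hqQ := interior_subset hq
  obtain ⟨t, ht0, ht1, htQ⟩ : ∃ t : ℝ, 0 < t ∧ t ≤ 1 ∧ t • x + (1 - t) • q ∈ Q.polytope := by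
    have hcont : Filter.Tendsto (fun t : ℝ => t • x + (1 - t) • q) (nhdsWithin 0 (Set.Ioi 0))
        (nhds q) := by
      have : Continuous (fun t : ℝ => t • x + (1 - t) • q) := by fun_prop
      have h := this.tendsto 0
      simp only [zero_smul, sub_zero, one_smul, zero_add] at h
      exact h.mono_left nhdsWithin_le_nhds
    have h1 := hcont.eventually (mem_interior_iff_mem_nhds.1 hq)
    have h2 : ∀ᶠ t : ℝ in nhdsWithin 0 (Set.Ioi 0), t ∈ Set.Ioc (0 : ℝ) 1 :=
      Ioc_mem_nhdsGT zero_lt_one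
    obtain ⟨t, h1, h2⟩ := (h1.and h2).exists
    exact ⟨t, h2.1, h2.2, h1⟩
  have h := hg.convexUpward.2 (1, x) (mem_cone_one hx) (1, q)
    (mem_cone_one (𝒬.polytope_subset hQ hqQ)) t ht0.le ht1
  have hcomb : t • ((1 : ℝ), x) + (1 - t) • ((1 : ℝ), q) = (1, t • x + (1 - t) • q) := by
    ext <;> simp
  rw [hφ (mem_cone_one hqQ)] at h
  have h2 : g (t • ((1 : ℝ), x) + (1 - t) • ((1 : ℝ), q)) =
      t • φ (1, x) + (1 - t) • φ (1, q) := by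
    rw [← LinearMap.map_smul, ← LinearMap.map_smul, ← map_add, hcomb, hφ (mem_cone_one htQ)]
  rw [h2, toLex_add, toLex_add, add_le_add_iff_right, toLex_smul_le_iff ht0] at h
  exact h

/-- If a cell is a domain of linearity, then its linear piece agrees with the concave map on the
cell only: the locus where they agree is convex and closed, hence the closure of its interior. -/
theorem IsAssociatedMap.mem_polytope_of_eq (hg : IsAssociatedMap 𝒬 Ψ g) (hQ : Q ∈ 𝒬.cells)
    (hlin : IsDomainOfLinearity P g Q.polytope) (hφ : Set.EqOn g φ (cone Q.polytope))
    {x : Fin d → ℝ} (hx : x ∈ P.polytope) (hgx : g (1, x) = φ (1, x)) : x ∈ Q.polytope := by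
  let D : Set (Fin d → ℝ) := P.polytope ∩ {y | g (1, y) - φ (1, y) = 0}
  have hQD : Q.polytope ⊆ D := fun y hy =>
    ⟨𝒬.polytope_subset hQ hy, sub_eq_zero.2 (hφ (mem_cone_one hy))⟩
  have hconv : Convex ℝ D := by
    intro y hy z hz a b ha hb hab
    obtain rfl : b = 1 - a := by linarith
    have hyz : a • y + (1 - a) • z ∈ P.polytope := P.polytope_convex hy.1 hz.1 ha hb hab
    refine ⟨hyz, sub_eq_zero.2 (toLex_inj.1 (le_antisymm (hg.le_cellMap hQ hφ hyz) ?_))⟩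
    have h := hg.convexUpward.2 (1, y) (mem_cone_one hy.1) (1, z) (mem_cone_one hz.1) a ha
      (by linarith)
    have hcomb : a • ((1 : ℝ), y) + (1 - a) • ((1 : ℝ), z) = (1, a • y + (1 - a) • z) := by
      ext <;> simp
    rw [hcomb, sub_eq_zero.1 hy.2, sub_eq_zero.1 hz.2, ← LinearMap.map_smul, ← LinearMap.map_smul,
      ← map_add, hcomb] at h
    exact h
  have hclosed : IsClosed D := by
    refine ContinuousOn.preimage_isClosed_of_isClosed (f := fun y => g (1, y) - φ (1, y))
      (t := {0}) ?_ P.polytope_isClosed isClosed_singleton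
    refine ContinuousOn.sub (hg.convexUpward.1.comp (by fun_prop) fun y hy => mem_cone_one hy) ?_
    exact (φ.continuous_of_finiteDimensional.comp (by fun_prop)).continuousOn
  have hint : (interior D).Nonempty := Q.interior_polytope_nonempty.mono (interior_mono hQD)
  have hDom : IsClosedDomain P.polytope D := by
    have hsub : interior D ∩ P.polytope = interior D :=
      Set.inter_eq_left.2 (interior_subset.trans Set.inter_subset_left)
    refine ⟨interior D, isOpen_interior, ?_, ?_⟩
    · rw [hsub]
      exact hconv.interior.isConnected hint
    · rw [hsub, hconv.closure_interior_eq_closure_of_nonempty_interior hint, hclosed.closure_eq]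
  have hDlin : LinearOn g (cone D) := by
    refine ⟨φ, fun z hz => ?_⟩
    obtain ⟨r, hr, y, hy, rfl⟩ := exists_of_mem_cone hconv (hint.mono interior_subset) hz
    rw [hg.map_smul hy.1 hr, sub_eq_zero.1 hy.2, LinearMap.map_smul]
  rw [← hlin.maximal D hDom hDlin hQD]
  exact ⟨hx, sub_eq_zero.2 hgx⟩

theorem IsAssociatedMap.le_of_mem_cone (hg : IsAssociatedMap 𝒬 Ψ g) (hQ : Q ∈ 𝒬.cells)
    (hφ : Set.EqOn g φ (cone Q.polytope)) {z : ℝ × (Fin d → ℝ)} (hz : z ∈ cone P.polytope) :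
    toLex (g z) ≤ toLex (φ z) := by
  obtain ⟨r, hr, x, hx, rfl⟩ := exists_of_mem_cone P.polytope_convex P.polytope_nonempty hz
  rw [hg.map_smul hx hr, LinearMap.map_smul]
  rcases hr.eq_or_lt with rfl | hr
  · rw [zero_smul, zero_smul]
  · exact (toLex_smul_le_iff hr).2 (hg.le_cellMap hQ hφ hx)

theorem IsAssociatedMap.mem_cone_iff (hg : IsAssociatedMap 𝒬 Ψ g) (hQ : Q ∈ 𝒬.cells)
    (hlin : IsDomainOfLinearity P g Q.polytope) (hφ : Set.EqOn g φ (cone Q.polytope))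
    {z : ℝ × (Fin d → ℝ)} (hz : z ∈ cone P.polytope) : z ∈ cone Q.polytope ↔ φ z = g z := by
  refine ⟨fun h => (hφ h).symm, fun h => ?_⟩
  obtain ⟨r, hr, x, hx, rfl⟩ := exists_of_mem_cone P.polytope_convex P.polytope_nonempty hz
  rw [hg.map_smul hx hr, LinearMap.map_smul] at h
  rcases hr.eq_or_lt with rfl | hr
  · rw [zero_smul]
    exact zero_mem _
  · exact smul_mem_cone hr.le
      (hg.mem_polytope_of_eq hQ hlin hφ hx (smul_right_injective _ hr.ne' h).symm)

end AssociatedMap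

section CellMap

variable {d N : ℕ} {P : MarkedPolytope d} {𝒬 : Subdivision P} {Ψ : Matrix (Fin N) P.A ℚ}

/-- The inclusion of `ℚ × M_ℚ` in `ℝ × M_ℝ`. -/
def ratToReal (d : ℕ) : ℚ × (Fin d → ℚ) →ₗ[ℚ] ℝ × (Fin d → ℝ) where
  toFun z := (z.1, fun i => z.2 i)
  map_add' z w := by ext <;> simp
  map_smul' c z := by ext <;> simp [Rat.smul_def]

theorem ratToReal_latticeToRat (u : ℕ × (Fin d → ℤ)) :
    ratToReal d (latticeToRat u) = latticeToReal u := by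
  ext <;> simp [ratToReal, latticeToRat, latticeToReal, toReal]

/-- The rational linear map `ψ_Q` is the restriction of the linear piece of `g_Ψ` on `Q`. -/
theorem ratVecCast_cellMap {g : ℝ × (Fin d → ℝ) → Fin N → ℝ}
    (hg : IsAssociatedMap 𝒬 (Ψ.map (Rat.cast : ℚ → ℝ)) g) {Q : MarkedPolytope d}
    (hQ : Q ∈ 𝒬.cells) {φ : ℝ × (Fin d → ℝ) →ₗ[ℝ] (Fin N → ℝ)}
    (hφ : Set.EqOn g φ (cone Q.polytope)) (z : ℚ × (Fin d → ℚ)) :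
    ratVecCast N (cellMap Ψ Q z) = φ (ratToReal d z) := by
  have hφΨ : ∀ χ : P.A, χ.1 ∈ Q.A → φ (ratToReal d (latticeToRat (1, χ.1))) =
      ratVecCast N (Ψ.col χ) := by
    intro χ hχ
    rw [ratToReal_latticeToRat]
    have h := hg.eq_of_marked χ ⟨Q, hQ, hχ⟩
    have hχ' : latticeToReal (1, χ.1) = ((1 : ℝ), toReal χ.1) := by
      simp [latticeToReal]
    rw [hχ', ← hφ (mem_cone_one (Q.mem_polytope hχ)), h]
    rfl
  have hex : ∃ ψ : ℚ × (Fin d → ℚ) →ₗ[ℚ] (Fin N → ℚ),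
      ∀ χ : P.A, χ.1 ∈ Q.A → ψ (latticeToRat (1, χ.1)) = Ψ.col χ := by
    -- compose with a `ℚ`-linear retraction of `ℝ^N` onto `ℚ^N`
    obtain ⟨ρ, hρ⟩ := (ratVecCast N).exists_leftInverse_of_injective
      (LinearMap.ker_eq_bot.2 ratVecCast_injective)
    refine ⟨ρ ∘ₗ φ.restrictScalars ℚ ∘ₗ ratToReal d, fun χ hχ => ?_⟩
    have h := congrArg ρ (hφΨ χ hχ)
    exact h.trans (LinearMap.congr_fun hρ _)
  have hspec : ∀ χ : P.A, χ.1 ∈ Q.A → cellMap Ψ Q (latticeToRat (1, χ.1)) = Ψ.col χ := by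
    rw [cellMap, dif_pos hex]
    exact hex.choose_spec
  have : (ratVecCast N) ∘ₗ cellMap Ψ Q = φ.restrictScalars ℚ ∘ₗ ratToReal d := by
    refine Q.linearMap_ext fun χ hχ => ?_
    have hχP := 𝒬.subset Q hQ hχ
    change ratVecCast N (cellMap Ψ Q _) = φ (ratToReal d _)
    rw [hspec ⟨χ, hχP⟩ hχ, hφΨ ⟨χ, hχP⟩ hχ]
  exact LinearMap.congr_fun this z

theorem latticeToReal_mem_cone (u : monoidS P) : latticeToReal u.1 ∈ cone P.polytope := by
  have : monoidS P ≤ (cone P.polytope).toAddSubmonoid.comap latticeToReal := by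
    refine AddSubmonoid.closure_le.2 ?_
    rintro _ ⟨χ, hχ, rfl⟩
    have hχ' : latticeToReal (1, χ) = ((1 : ℝ), toReal χ) := by
      simp [latticeToReal]
    change latticeToReal (1, χ) ∈ cone P.polytope
    rw [hχ']
    exact mem_cone_one (P.mem_polytope hχ)
  exact this u.2

/-- The combinatorial content of `Ψ ∈ C(𝒬, N)`: the lattice points of `K(Q)` are those at which the
minimum that defines `g_Ψ` is attained by the linear map of `Q`. -/
def IsAdapted (𝒬 : Subdivision P) (Ψ : Matrix (Fin N) P.A ℚ) : Prop :=
  ∀ Q ∈ 𝒬.cells, ∀ u : monoidS P,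
    u.1 ∈ monoidSQ P Q ↔ toValue (cellMap Ψ Q (latticeToRat u.1)) = weight 𝒬 Ψ u

/-- On `K(P)` the map `g_Ψ` lies below the linear map of each cell `Q`, with equality exactly on
`K(Q)`. -/
theorem isAdapted_of_mem_openGKZCone (hΨ : Ψ.map (Rat.cast : ℚ → ℝ) ∈ openGKZCone 𝒬 N) :
    IsAdapted 𝒬 Ψ := by
  obtain ⟨g, hg, hdom⟩ := hΨ
  intro Q hQ u
  have hz := latticeToReal_mem_cone u
  have hlin : ∀ Q ∈ 𝒬.cells, IsDomainOfLinearity P g Q.polytope := by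
    intro Q hQ
    have : (Q.polytope, (Q.A : Set (Fin d → ℤ))) ∈
        {X : Set (Fin d → ℝ) × Set (Fin d → ℤ) | ∃ B ∈ 𝒬.cells, X = (B.polytope, ↑B.A)} :=
      ⟨Q, hQ, rfl⟩
    rw [← hdom] at this
    exact this.1
  have hval : ∀ Q ∈ 𝒬.cells,
      toLex (g (latticeToReal u.1)) ≤ toLex (ratVecCast N (cellMap Ψ Q (latticeToRat u.1))) ∧
      (latticeToReal u.1 ∈ cone Q.polytope ↔
        ratVecCast N (cellMap Ψ Q (latticeToRat u.1)) = g (latticeToReal u.1)) := by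
    intro Q hQ
    obtain ⟨φ, hφ⟩ := hg.piecewiseLinear Q hQ
    rw [ratVecCast_cellMap hg hQ hφ, ratToReal_latticeToRat]
    exact ⟨hg.le_of_mem_cone hQ hφ hz, hg.mem_cone_iff hQ (hlin Q hQ) hφ hz⟩
  obtain ⟨Q₀, hQ₀, hz₀⟩ := 𝒬.exists_mem_cone hz
  have h₀ := (hval Q₀ hQ₀).2.1 hz₀
  have hw : weight 𝒬 Ψ u = toValue (cellMap Ψ Q₀ (latticeToRat u.1)) := by
    refine le_antisymm (Finset.inf'_le _ hQ₀) (Finset.le_inf' _ _ fun Q' hQ' => ?_)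
    rw [toValue_le_iff, h₀]
    exact (hval Q' hQ').1
  have hmem : u.1 ∈ monoidSQ P Q ↔ latticeToReal u.1 ∈ cone Q.polytope :=
    ⟨fun h => h.2, fun h => ⟨u.2, h⟩⟩
  rw [hmem, (hval Q hQ).2, hw, ← h₀]
  exact ⟨fun h => congrArg toValue (ratVecCast_injective h), fun h => congrArg (ratVecCast N) h⟩

theorem exists_cell_of_monoidS (𝒬 : Subdivision P) (u : monoidS P) :
    ∃ Q ∈ 𝒬.cells, u.1 ∈ monoidSQ P Q := by
  obtain ⟨Q, hQ, h⟩ := 𝒬.exists_mem_cone (latticeToReal_mem_cone u)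
  exact ⟨Q, hQ, u.2, h⟩

/-- Weights add up exactly for elements of a common cone: `ψ_Q(u + v) = ψ_Q(u) + ψ_Q(v)` can be
minimal only if both summands are. -/
theorem IsAdapted.add_mem_iff (h : IsAdapted 𝒬 Ψ) {Q : MarkedPolytope d} (hQ : Q ∈ 𝒬.cells)
    (u v : monoidS P) :
    ((u + v).1 ∈ monoidSQ P Q ∧ weight 𝒬 Ψ (u + v) = weight 𝒬 Ψ u + weight 𝒬 Ψ v) ↔
      u.1 ∈ monoidSQ P Q ∧ v.1 ∈ monoidSQ P Q := by
  have hadd : toValue (cellMap Ψ Q (latticeToRat (u + v).1)) =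
      toValue (cellMap Ψ Q (latticeToRat u.1)) + toValue (cellMap Ψ Q (latticeToRat v.1)) := by
    rw [AddSubmonoid.coe_add, map_add, map_add, map_add]
  have hu : weight 𝒬 Ψ u ≤ toValue (cellMap Ψ Q (latticeToRat u.1)) := Finset.inf'_le _ hQ
  have hv : weight 𝒬 Ψ v ≤ toValue (cellMap Ψ Q (latticeToRat v.1)) := Finset.inf'_le _ hQ
  constructor
  · rintro ⟨huv, hw⟩
    rw [h Q hQ, hadd, hw] at huv
    rw [h Q hQ, h Q hQ]
    have h1 := (add_eq_add_iff_eq_and_eq hu hv).1 huv.symm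
    exact ⟨h1.1.symm, h1.2.symm⟩
  · rintro ⟨huQ, hvQ⟩
    have huvQ : (u + v).1 ∈ monoidSQ P Q := add_mem huQ hvQ
    refine ⟨huvQ, ?_⟩
    rw [← (h Q hQ _).1 huvQ, hadd, (h Q hQ _).1 huQ, (h Q hQ _).1 hvQ]

end CellMap

/-! ### The monoids of the cells -/

section Monoids

/-- A form of Gordan's lemma: a monoid is finitely generated if its elements are sums of finitely
many of its elements, up to remainders from a finite set. For each remainder only the minimal
exponent vectors are needed, and by Dickson's lemma these are finite in number. -/
theorem addSubmonoid_fg_of_remainders {G ι : Type*} [AddCommMonoid G] [Fintype ι]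
    (S : AddSubmonoid G) (t : ι → G) (ht : ∀ i, t i ∈ S) {F : Set G} (hF : F.Finite)
    (h : ∀ u ∈ S, ∃ ρ ∈ F, ∃ β : ι → ℕ, u = ρ + ∑ i, β i • t i) : S.FG := by
  let B : G → Set (ι → ℕ) := fun ρ => {β | ρ + ∑ i, β i • t i ∈ S}
  let m : G → Set (ι → ℕ) := fun ρ => {β | Minimal (· ∈ B ρ) β}
  have hm : ∀ ρ, (m ρ).Finite := fun ρ =>
    WellQuasiOrderedLE.finite_of_isAntichain (setOfPred_minimal_antichain _)
  refine (AddSubmonoid.fg_iff S).2 ⟨Set.range t ∪ ⋃ ρ ∈ F, (fun β => ρ + ∑ i, β i • t i) '' m ρ,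
    le_antisymm ?_ ?_, (Set.finite_range t).union (hF.biUnion fun ρ _ => (hm ρ).image _)⟩
  · refine AddSubmonoid.closure_le.2 (Set.union_subset ?_ ?_)
    · rintro _ ⟨i, rfl⟩
      exact ht i
    · refine Set.iUnion₂_subset fun ρ _ => ?_
      rintro _ ⟨β, hβ, rfl⟩
      exact hβ.prop
  · intro u hu
    obtain ⟨ρ, hρ, β, rfl⟩ := h u hu
    obtain ⟨γ, hγβ, hγ⟩ := exists_minimal_le_of_wellFoundedLT (· ∈ B ρ) β hu
    have hsum : ρ + ∑ i, β i • t i = (ρ + ∑ i, γ i • t i) + ∑ i, (β i - γ i) • t i := by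
      rw [add_assoc, ← Finset.sum_add_distrib]
      congr 1
      refine Finset.sum_congr rfl fun i _ => ?_
      rw [← add_smul, Nat.add_sub_cancel' (hγβ i)]
    rw [hsum]
    refine add_mem (AddSubmonoid.subset_closure (Set.mem_union_right _ ?_))
      (sum_mem fun i _ => nsmul_mem
        (AddSubmonoid.subset_closure (Set.mem_union_left _ (Set.mem_range_self i))) _)
    exact Set.mem_biUnion hρ ⟨γ, hγ, rfl⟩

variable {d : ℕ} {P : MarkedPolytope d}

theorem latticeToReal_one (χ : Fin d → ℤ) : latticeToReal (1, χ) = ((1 : ℝ), toReal χ) := by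
  simp [latticeToReal]

theorem mem_monoidSQ {Q : MarkedPolytope d} (hQ : Q.A ⊆ P.A) {χ : Fin d → ℤ} (hχ : χ ∈ Q.A) :
    ((1, χ) : ℕ × (Fin d → ℤ)) ∈ monoidSQ P Q := by
  refine ⟨AddSubmonoid.subset_closure ⟨χ, hQ hχ, rfl⟩, ?_⟩
  change latticeToReal (1, χ) ∈ cone Q.polytope
  rw [latticeToReal_one]
  exact mem_cone_one (Q.mem_polytope hχ)

theorem monoidS_fg (P : MarkedPolytope d) : (monoidS P).FG :=
  (AddSubmonoid.fg_iff _).2 ⟨_, rfl, P.A.finite_toSet.image _⟩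

theorem eq_zero_of_mem_monoidS {w : ℕ × (Fin d → ℤ)} (hw : w ∈ monoidS P) (h0 : w.1 = 0) :
    w = 0 := by
  induction hw using AddSubmonoid.closure_induction with
  | mem w h =>
    obtain ⟨χ, -, rfl⟩ := h
    exact absurd h0 one_ne_zero
  | zero => rfl
  | add u v _ _ hu hv =>
    have h : u.1 + v.1 = 0 := h0
    rw [hu (by omega), hv (by omega), add_zero]

/-- The points of the cone over a polytope are the non-negative combinations of the `(1, χ)`. -/
theorem exists_coeff_of_mem_cone (Q : MarkedPolytope d) {z : ℝ × (Fin d → ℝ)}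
    (hz : z ∈ cone Q.polytope) :
    ∃ r : Q.A → ℝ, (∀ χ, 0 ≤ r χ) ∧ z = ∑ χ, r χ • latticeToReal (1, χ.1) := by
  obtain ⟨s, hs, x, hx, rfl⟩ := exists_of_mem_cone Q.polytope_convex Q.polytope_nonempty hz
  have hx' : x ∈ convexHull ℝ (Set.range fun χ : Q.A => toReal χ.1) := by
    have : (Set.range fun χ : Q.A => toReal χ.1) = toReal '' (Q.A : Set (Fin d → ℤ)) := by
      ext y
      simp
    rw [this]
    exact hx
  rw [convexHull_range_eq_exists_affineCombination] at hx'
  obtain ⟨t, w, hw0, hw1, rfl⟩ := hx'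
  rw [t.affineCombination_eq_linear_combination _ _ hw1] at hx ⊢
  refine ⟨fun χ => if χ ∈ t then s * w χ else 0, fun χ => ?_, ?_⟩
  · dsimp only
    split_ifs with h
    · exact mul_nonneg hs (hw0 χ h)
    · exact le_rfl
  · simp only [latticeToReal_one, ite_smul, zero_smul, Finset.sum_ite_mem, Finset.univ_inter,
      mul_smul, ← Finset.smul_sum]
    congr 1
    ext i
    · simp [Prod.fst_sum, hw1]
    · simp [Prod.snd_sum]

/-- An element of `S_Q` is a non-negative real combination of the `(1, χ)`, `χ ∈ A_Q`. Subtracting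
the integral parts of the coefficients leaves a lattice point of a bounded region. -/
theorem monoidSQ_fg {Q : MarkedPolytope d} (hQ : Q.A ⊆ P.A) : (monoidSQ P Q).FG := by
  let C : Fin d → ℤ := fun i => ∑ χ : Q.A, |χ.1 i|
  refine addSubmonoid_fg_of_remainders (monoidSQ P Q) (fun χ : Q.A => (1, χ.1))
    (fun χ => mem_monoidSQ hQ χ.2)
    ((Set.finite_Icc 0 (Fintype.card Q.A)).prod (Set.finite_Icc (-C) C)) fun u hu => ?_
  obtain ⟨r, hr0, hr⟩ := exists_coeff_of_mem_cone Q hu.2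
  let β : Q.A → ℕ := fun χ => ⌊r χ⌋₊
  have hβ : ∀ χ, (β χ : ℝ) ≤ r χ := fun χ => Nat.floor_le (hr0 χ)
  have hβ' : ∀ χ, r χ - β χ ≤ 1 := fun χ => by
    have := Nat.lt_floor_add_one (r χ)
    simp only [β]
    linarith
  have hu1 : (u.1 : ℝ) = ∑ χ, r χ := by
    have := congrArg Prod.fst hr
    simpa [latticeToReal, Prod.fst_sum] using this
  have hu2 : ∀ i, (u.2 i : ℝ) = ∑ χ, r χ * (χ.1 i : ℝ) := by
    intro i
    have := congrFun (congrArg Prod.snd hr) i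
    simpa [latticeToReal, Prod.snd_sum, toReal] using this
  have hle : ∑ χ, β χ ≤ u.1 := by
    have : (∑ χ, (β χ : ℝ)) ≤ u.1 := by
      rw [hu1]
      exact Finset.sum_le_sum fun χ _ => hβ χ
    exact_mod_cast this
  have habs : ∀ i, |u.2 i - ∑ χ, (β χ : ℤ) * χ.1 i| ≤ C i := by
    intro i
    have : |(u.2 i : ℝ) - ∑ χ, (β χ : ℝ) * χ.1 i| ≤ ∑ χ : Q.A, |(χ.1 i : ℝ)| := by
      rw [hu2, ← Finset.sum_sub_distrib]
      refine (Finset.abs_sum_le_sum_abs _ _).trans (Finset.sum_le_sum fun χ _ => ?_)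
      rw [← sub_mul, abs_mul, abs_of_nonneg (sub_nonneg.2 (hβ χ))]
      exact mul_le_of_le_one_left (abs_nonneg _) (hβ' χ)
    exact_mod_cast this
  refine ⟨(u.1 - ∑ χ, β χ, u.2 - ∑ χ, β χ • χ.1), ⟨⟨Nat.zero_le _, ?_⟩, ⟨?_, ?_⟩⟩, β, ?_⟩
  · have : (u.1 : ℝ) ≤ ∑ χ, β χ + Fintype.card Q.A := by
      have h1 : ∑ χ, (r χ - β χ) ≤ ∑ _χ : Q.A, (1 : ℝ) := Finset.sum_le_sum fun χ _ => hβ' χ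
      rw [Finset.sum_sub_distrib, ← hu1] at h1
      simp only [Finset.sum_const, Finset.card_univ, nsmul_eq_mul, mul_one] at h1
      push_cast
      linarith
    have h2 : u.1 ≤ ∑ χ, β χ + Fintype.card Q.A := by exact_mod_cast this
    change u.1 - _ ≤ _
    omega
  · intro i
    have := neg_le_of_abs_le (habs i)
    simpa [Finset.sum_apply] using this
  · intro i
    have := le_of_abs_le (habs i)
    simpa [Finset.sum_apply] using this
  · refine Prod.ext ?_ ?_
    · simp only [Prod.fst_add, Prod.fst_sum, Prod.smul_fst, smul_eq_mul, mul_one]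
      omega
    · simp only [Prod.snd_add, Prod.snd_sum, Prod.smul_snd, sub_add_cancel]

/-- A monoid that contains all `(1, χ)` with `χ` in a full-dimensional marking has full rank: the
vectors with a multiple in the group it generates form a rational subspace. -/
theorem hasFullRank_of_marking (Q : MarkedPolytope d) {M : AddSubmonoid (ℕ × (Fin d → ℤ))}
    (hM : ∀ χ ∈ Q.A, ((1, χ) : ℕ × (Fin d → ℤ)) ∈ M) : HasFullRank M := by
  let V : Submodule ℚ (ℚ × (Fin d → ℚ)) :=
    { carrier := {z | ∃ n : ℕ, 0 < n ∧ ∃ a ∈ M, ∃ b ∈ M, n • z = latticeToRat a - latticeToRat b}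
      zero_mem' := ⟨1, one_pos, 0, zero_mem _, 0, zero_mem _, by simp⟩
      add_mem' := by
        rintro z w ⟨n, hn, a, ha, b, hb, h⟩ ⟨m, hm, a', ha', b', hb', h'⟩
        refine ⟨n * m, Nat.mul_pos hn hm,
          m • a + n • a', add_mem (nsmul_mem ha _) (nsmul_mem ha' _),
          m • b + n • b', add_mem (nsmul_mem hb _) (nsmul_mem hb' _), ?_⟩
        have e1 : (n * m) • (z + w) = m • (n • z) + n • (m • w) := by
          rw [smul_add, mul_comm, mul_smul, mul_comm, mul_smul]
        rw [e1, h, h']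
        simp only [map_add, map_nsmul, smul_sub]
        abel
      smul_mem' := by
        rintro c z ⟨n, hn, a, ha, b, hb, h⟩
        have e1 : (c.den * n) • (c • z) = c.num • (n • z) := by
          simp only [← Int.cast_smul_eq_zsmul ℚ, ← Nat.cast_smul_eq_nsmul ℚ, smul_smul]
          congr 1
          push_cast
          have := c.den_mul_eq_num
          linear_combination (n : ℚ) * this
        rcases Int.eq_nat_or_neg c.num with ⟨k, hk | hk⟩
        · refine ⟨c.den * n, Nat.mul_pos c.den_pos hn, k • a, nsmul_mem ha _, k • b,
            nsmul_mem hb _, ?_⟩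
          rw [e1, h, hk, natCast_zsmul, smul_sub, map_nsmul, map_nsmul]
        · refine ⟨c.den * n, Nat.mul_pos c.den_pos hn, k • b, nsmul_mem hb _, k • a,
            nsmul_mem ha _, ?_⟩
          rw [e1, h, hk, neg_smul, natCast_zsmul, smul_sub, map_nsmul, map_nsmul, neg_sub] }
  have hV : V = ⊤ := by
    rw [eq_top_iff, ← Q.span_latticeToRat]
    refine Submodule.span_le.2 ?_
    rintro _ ⟨χ, hχ, rfl⟩
    exact ⟨1, one_pos, (1, χ), hM χ hχ, 0, zero_mem _, by simp⟩
  intro z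
  have hz : ((0, fun i => (z i : ℚ)) : ℚ × (Fin d → ℚ)) ∈ V := hV ▸ Submodule.mem_top
  obtain ⟨n, hn, a, ha, b, hb, h⟩ := hz
  refine ⟨n, hn, a, ha, b, hb, ?_, ?_⟩
  · have := congrArg Prod.fst h
    simp only [latticeToRat, AddMonoidHom.coe_mk, ZeroHom.coe_mk, Prod.smul_fst, smul_zero,
      Prod.fst_sub] at this
    have h' : (a.1 : ℚ) = b.1 := by linarith
    exact_mod_cast h'
  · ext i
    have := congrFun (congrArg Prod.snd h) i
    have h' : (n : ℚ) * z i = a.2 i - b.2 i := by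
      simpa [latticeToRat] using this
    simp only [Pi.smul_apply, Pi.sub_apply, nsmul_eq_mul]
    exact_mod_cast h'

/-- The sum of the `(1, χ)` with `χ` in the marking of `Q`; it lies in the interior of `K(Q)`. -/
def markingSum (Q : MarkedPolytope d) : ℕ × (Fin d → ℤ) := ∑ χ ∈ Q.A, (1, χ)

theorem markingSum_mem {Q : MarkedPolytope d} (hQ : Q.A ⊆ P.A) : markingSum Q ∈ monoidSQ P Q :=
  sum_mem fun _ hχ => mem_monoidSQ hQ hχ

/-- The barycenter of the marking of a cell lies in no other cell: a face of `Q` that contains it is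
all of `Q`, and a full-dimensional face of `Q'` is all of `Q'`. -/
theorem eq_of_markingSum_mem {𝒬 : Subdivision P} {Q Q' : MarkedPolytope d} (hQ : Q ∈ 𝒬.cells)
    (hQ' : Q' ∈ 𝒬.cells) (h : markingSum Q ∈ monoidSQ P Q') : Q = Q' := by
  have hn : (0 : ℝ) < Q.A.card := Nat.cast_pos.2 Q.nonempty.card_pos
  set x : Fin d → ℝ := (Q.A.card : ℝ)⁻¹ • ∑ χ ∈ Q.A, toReal χ with hx
  have hnx : (Q.A.card : ℝ) • x = ∑ χ ∈ Q.A, toReal χ := by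
    rw [hx, smul_smul, mul_inv_cancel₀ hn.ne', one_smul]
  have hsum : latticeToReal (markingSum Q) = (Q.A.card : ℝ) • ((1 : ℝ), x) := by
    rw [Prod.smul_mk, hnx, markingSum, map_sum]
    simp only [latticeToReal_one]
    ext i
    · simp [Prod.fst_sum]
    · simp [Prod.snd_sum]
  have hxmem : ∀ R : MarkedPolytope d, markingSum Q ∈ monoidSQ P R → x ∈ R.polytope := by
    intro R hR
    have h2 : latticeToReal (markingSum Q) ∈ cone R.polytope := hR.2
    rw [hsum] at h2
    exact (smul_mem_cone_iff R.polytope_convex R.polytope_nonempty hn).1 h2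
  have hxQ := hxmem Q (markingSum_mem (𝒬.subset Q hQ))
  have hxQ' := hxmem Q' h
  have hsub : Q.polytope ⊆ Q'.polytope := by
    obtain ⟨l, hl⟩ := 𝒬.face Q hQ Q' hQ' ⟨x, hxQ, hxQ'⟩
    have hmax : ∀ y ∈ Q.polytope, l y ≤ l x := by
      have : x ∈ Q.polytope ∩ Q'.polytope := ⟨hxQ, hxQ'⟩
      rw [hl] at this
      exact this.2
    have heq : ∀ χ ∈ Q.A, l (toReal χ) = l x := by
      refine (Finset.sum_eq_sum_iff_of_le fun χ hχ => hmax _ (Q.mem_polytope hχ)).1 ?_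
      rw [← map_sum, ← hnx, map_smul, Finset.sum_const, nsmul_eq_mul, smul_eq_mul]
    refine convexHull_min ?_ Q'.polytope_convex
    rintro _ ⟨χ, hχ, rfl⟩
    have : toReal χ ∈ Q.polytope ∩ Q'.polytope := by
      rw [hl]
      exact ⟨Q.mem_polytope hχ, fun y hy => (hmax y hy).trans (heq χ hχ).ge⟩
    exact this.2
  have hsup : Q'.polytope ⊆ Q.polytope := by
    obtain ⟨l, hl⟩ := 𝒬.face Q' hQ' Q hQ ⟨x, hxQ', hxQ⟩
    rw [Set.inter_eq_right.2 hsub] at hl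
    have hmax : ∀ z ∈ Q.polytope, ∀ y ∈ Q'.polytope, l y ≤ l z := by
      intro z hz
      rw [hl] at hz
      exact hz.2
    have hconst : (l.toLinearMap.toAffineMap : (Fin d → ℝ) →ᵃ[ℝ] ℝ) =
        AffineMap.const ℝ (Fin d → ℝ) (l x) := by
      refine AffineMap.ext_on Q.spans ?_
      rintro _ ⟨χ, hχ, rfl⟩
      exact le_antisymm (hmax _ hxQ _ (hsub (Q.mem_polytope hχ)))
        (hmax _ (Q.mem_polytope hχ) _ hxQ')
    have hc : ∀ y, l y = l x := fun y => congrArg (fun f : (Fin d → ℝ) →ᵃ[ℝ] ℝ => f y) hconst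
    intro y hy
    rw [hl]
    exact ⟨hy, fun z _ => (hc z).trans (hc y).symm |>.le⟩
  refine MarkedPolytope.ext_A (Finset.Subset.antisymm ?_ ?_)
  · exact fun χ hχ => 𝒬.marking Q hQ Q' hQ' χ hχ (hsub (Q.mem_polytope hχ))
  · exact fun χ hχ => 𝒬.marking Q' hQ' Q hQ χ hχ (hsup (Q'.mem_polytope hχ))

end Monoids

/-! ### The associated graded algebra -/

noncomputable section AssociatedGraded

open AddMonoidAlgebra

variable (K : Type u) [Field K] [CharZero K] {d N : ℕ} {P : MarkedPolytope d}

theorem map_coordGrade (i : ℕ) :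
    (coordGrade K P i).map (coordEquiv K P).toLinearMap = monoidGrade K (monoidS P) i := by
  refine le_antisymm ?_ fun x hx => ?_
  · rintro _ ⟨x, hx, rfl⟩
    exact coordEquiv_mem K P hx
  · refine ⟨(coordEquiv K P).symm x, ?_, (coordEquiv K P).apply_symm_apply x⟩
    have h : coordProj K P i ((coordEquiv K P).symm x) = (coordEquiv K P).symm x := by
      simp only [coordProj, LinearMap.comp_apply, AlgEquiv.toLinearMap_apply,
        AlgEquiv.apply_symm_apply]
      congr 1
      ext u
      by_cases hu : deg (monoidS P) u = i
      · simp [restrictDeg, hu]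
      · have : x.coeff u = 0 := by
          by_contra h0
          exact hu (hx u (Finsupp.mem_support_iff.2 h0))
        simp [restrictDeg, hu, this]
    rw [← h, ← proj_eq_coordProj]
    exact SetLike.coe_mem _

theorem basisFn_mem_coordGrade (u : monoidS P) : basisFn K P u ∈ coordGrade K P u.1.1 := by
  have h := single_mem_monoidGrade (K := K) u 1
  rw [← map_coordGrade] at h
  obtain ⟨x, hx, h⟩ := h
  have : basisFn K P u = x := by
    rw [basisFn, ← h]
    exact (coordEquiv K P).symm_apply_apply x
  rwa [this]

theorem basisFn_add (u v : monoidS P) :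
    basisFn K P (u + v) = basisFn K P u * basisFn K P v := by
  rw [basisFn, basisFn, basisFn, ← map_mul, single_mul_single, one_mul]

theorem sum_smul_basisFn (f : CoordRing K P) :
    ∑ u ∈ (coordEquiv K P f).coeff.support, (coordEquiv K P f).coeff u • basisFn K P u = f := by
  apply (coordEquiv K P).injective
  rw [map_sum]
  conv_rhs => rw [← sum_coeff_single (coordEquiv K P f), Finsupp.sum]
  refine Finset.sum_congr rfl fun u _ => ?_
  rw [map_smul, basisFn, AlgEquiv.apply_symm_apply, smul_single, smul_eq_mul, mul_one]

variable (𝒬 : Subdivision P) (Ψ : Matrix (Fin N) P.A ℚ)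

theorem mem_filtGE_iff {a : ValueGroup N} {f : CoordRing K P} :
    f ∈ (quasiVal K 𝒬 Ψ).filtGE a ↔
      ∀ u ∈ (coordEquiv K P f).coeff.support, a ≤ weight 𝒬 Ψ u := by
  change (a : WithTop (ValueGroup N)) ≤ Finset.inf _ _ ↔ _
  simp only [Finset.le_inf_iff, WithTop.coe_le_coe]

theorem mem_filtGT_iff {a : ValueGroup N} {f : CoordRing K P} :
    f ∈ (quasiVal K 𝒬 Ψ).filtGT a ↔
      ∀ u ∈ (coordEquiv K P f).coeff.support, a < weight 𝒬 Ψ u := by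
  change (a : WithTop (ValueGroup N)) < Finset.inf _ _ ↔ _
  rw [Finset.lt_inf_iff (WithTop.coe_lt_top a)]
  simp only [WithTop.coe_lt_coe]

theorem basisFn_mem_filtGE {a : ValueGroup N} {u : monoidS P} (h : a ≤ weight 𝒬 Ψ u) :
    basisFn K P u ∈ (quasiVal K 𝒬 Ψ).filtGE a :=
  le_trans (WithTop.coe_le_coe.2 h) (basisFn_mem K 𝒬 Ψ u)

theorem cls_basisFn {a : ValueGroup N} {u : monoidS P} (h : a ≤ weight 𝒬 Ψ u)
    (h' : basisFn K P u ∈ (quasiVal K 𝒬 Ψ).filtGE a) :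
    (quasiVal K 𝒬 Ψ).cls a ⟨basisFn K P u, h'⟩ =
      if weight 𝒬 Ψ u = a then grBasisFn K 𝒬 Ψ u else 0 := by
  split_ifs with hu
  · subst hu
    rfl
  · have hlt : a < weight 𝒬 Ψ u := lt_of_le_of_ne h (Ne.symm hu)
    rw [QuasiValuation.cls, LinearMap.comp_apply, QuasiValuation.leafMk_eq_zero, map_zero]
    exact lt_of_lt_of_le (WithTop.coe_lt_coe.2 hlt) (basisFn_mem K 𝒬 Ψ u)

/-- Multiplication of the basis of the associated graded algebra. -/
theorem grBasisFn_mul (u v : monoidS P) :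
    grBasisFn K 𝒬 Ψ u * grBasisFn K 𝒬 Ψ v =
      if weight 𝒬 Ψ (u + v) = weight 𝒬 Ψ u + weight 𝒬 Ψ v then grBasisFn K 𝒬 Ψ (u + v) else 0 := by
  rw [← cls_basisFn K 𝒬 Ψ (weight_add 𝒬 Ψ u v)
    (basisFn_mem_filtGE K 𝒬 Ψ (weight_add 𝒬 Ψ u v)), grBasisFn, grBasisFn,
    QuasiValuation.cls_mul]
  congr 1
  ext
  exact (basisFn_add K u v).symm

theorem grBasisFn_zero : grBasisFn K 𝒬 Ψ 0 = 1 := by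
  have h1 : basisFn K P 0 = 1 := by
    rw [basisFn, ← AddMonoidAlgebra.one_def, map_one]
  have h2 := cls_basisFn K 𝒬 Ψ (weight_zero 𝒬 Ψ).ge
    (basisFn_mem_filtGE K 𝒬 Ψ (weight_zero 𝒬 Ψ).ge)
  rw [if_pos (weight_zero 𝒬 Ψ)] at h2
  rw [← h2]
  change _ = (quasiVal K 𝒬 Ψ).cls 0 _
  congr 1
  ext
  exact h1

/-- The class of `f` is a combination of the `f̄_u` with `u` in the support of `f`. -/
theorem cls_mem_span {a : ValueGroup N} (f : (quasiVal K 𝒬 Ψ).filtGE a) :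
    (quasiVal K 𝒬 Ψ).cls a f ∈
      Submodule.span K (grBasisFn K 𝒬 Ψ '' (coordEquiv K P f.1).coeff.support) := by
  have hle := (mem_filtGE_iff K 𝒬 Ψ).1 f.2
  have hf : f = ∑ u ∈ (coordEquiv K P f.1).coeff.support.attach, (coordEquiv K P f.1).coeff u.1 •
      (⟨basisFn K P u.1, basisFn_mem_filtGE K 𝒬 Ψ (hle u.1 u.2)⟩ :
        (quasiVal K 𝒬 Ψ).filtGE a) := by
    ext
    rw [AddSubmonoidClass.coe_finsetSum]
    conv_lhs => rw [← sum_smul_basisFn K f.1, ← Finset.sum_attach]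
    rfl
  have hcls := congrArg ((quasiVal K 𝒬 Ψ).cls a) hf
  rw [map_sum] at hcls
  rw [hcls]
  refine sum_mem fun u _ => ?_
  rw [map_smul, cls_basisFn K 𝒬 Ψ (hle u.1 u.2)]
  refine Submodule.smul_mem _ _ ?_
  split_ifs
  · exact Submodule.subset_span ⟨u.1, u.2, rfl⟩
  · exact zero_mem _

theorem span_grBasisFn : Submodule.span K (Set.range (grBasisFn K 𝒬 Ψ)) = ⊤ := by
  rw [eq_top_iff]
  intro x _
  induction x using DirectSum.induction_on with
  | zero => exact zero_mem _
  | add x y hx hy => exact add_mem (hx trivial) (hy trivial)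
  | of a x =>
    obtain ⟨f, rfl⟩ := (quasiVal K 𝒬 Ψ).leafMk_surjective a x
    exact Submodule.span_mono (Set.image_subset_range _ _) (cls_mem_span K 𝒬 Ψ f)

theorem grVDeg_eq_span (i : ℕ) :
    grVDeg K 𝒬 Ψ i = Submodule.span K (grBasisFn K 𝒬 Ψ '' {u | u.1.1 = i}) := by
  refine le_antisymm (Submodule.span_le.2 ?_) (Submodule.span_le.2 ?_)
  · rintro _ ⟨a, f, hf, rfl⟩
    refine Submodule.span_mono (Set.image_mono fun u hu => ?_) (cls_mem_span K 𝒬 Ψ f)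
    exact coordEquiv_mem K P hf u hu
  · rintro _ ⟨u, rfl, rfl⟩
    exact Submodule.subset_span ⟨_, _, basisFn_mem_coordGrade K u, rfl⟩

/-! ### The projections to the semigroup algebras of the cells -/

open Classical in
/-- `χ^u` if `u ∈ S_Q`, and `0` otherwise. -/
def cellMonomial (Q : MarkedPolytope d) (u : monoidS P) : AddMonoidAlgebra K (monoidSQ P Q) :=
  if h : u.1 ∈ monoidSQ P Q then single ⟨u.1, h⟩ 1 else 0

/-- The linear map on the coordinate ring that takes `f_u` to `χ^u` if `u ∈ S_Q` has weight `a`, and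
to `0` otherwise. -/
def coordToCell (Q : MarkedPolytope d) (a : ValueGroup N) :
    CoordRing K P →ₗ[K] AddMonoidAlgebra K (monoidSQ P Q) :=
  Finsupp.linearCombination K
      (fun u => if weight 𝒬 Ψ u = a then cellMonomial K Q u else 0) ∘ₗ
    (coeffLinearEquiv K).toLinearMap ∘ₗ (coordEquiv K P).toLinearMap

theorem coordToCell_apply (Q : MarkedPolytope d) (a : ValueGroup N) (f : CoordRing K P) :
    coordToCell K 𝒬 Ψ Q a f = ∑ u ∈ (coordEquiv K P f).coeff.support,
      (coordEquiv K P f).coeff u • if weight 𝒬 Ψ u = a then cellMonomial K Q u else 0 := rfl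

/-- The linear map `gr → K[S_Q]` with `f̄_u ↦ χ^u` for `u ∈ S_Q` and `f̄_u ↦ 0` for the others. -/
def grToCellLinear (Q : MarkedPolytope d) :
    GrV K 𝒬 Ψ →ₗ[K] AddMonoidAlgebra K (monoidSQ P Q) :=
  DirectSum.toModule K (ValueGroup N) _ fun a =>
    Submodule.liftQ _ (coordToCell K 𝒬 Ψ Q a ∘ₗ ((quasiVal K 𝒬 Ψ).filtGE a).subtype)
      fun f hf => by
        rw [LinearMap.mem_ker, LinearMap.comp_apply, Submodule.subtype_apply, coordToCell_apply]
        refine Finset.sum_eq_zero fun u hu => ?_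
        rw [if_neg ((mem_filtGT_iff K 𝒬 Ψ).1 hf u hu).ne', smul_zero]

theorem grToCellLinear_grBasisFn (Q : MarkedPolytope d) (u : monoidS P) :
    grToCellLinear K 𝒬 Ψ Q (grBasisFn K 𝒬 Ψ u) = cellMonomial K Q u := by
  have h : grToCellLinear K 𝒬 Ψ Q (grBasisFn K 𝒬 Ψ u) =
      coordToCell K 𝒬 Ψ Q (weight 𝒬 Ψ u) (basisFn K P u) :=
    DirectSum.toModule_lof K _ _
  have hs : (Finsupp.single u (1 : K)).support = {u} := Finsupp.support_single _ one_ne_zero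
  rw [h, coordToCell_apply, basisFn, AlgEquiv.apply_symm_apply, coeff_single, hs,
    Finset.sum_singleton, Finsupp.single_eq_same, one_smul, if_pos rfl]

variable {𝒬 Ψ}

omit [CharZero K] in
/-- The `χ^u`, `u ∈ S_Q`, and zeros multiply as the `f̄_u` do, since `f̄_u f̄_v` is non-zero with
`u + v ∈ S_Q` only if `u` and `v` lie in `S_Q`. -/
theorem IsAdapted.cellMonomial_mul (h : IsAdapted 𝒬 Ψ) {Q : MarkedPolytope d} (hQ : Q ∈ 𝒬.cells)
    (u v : monoidS P) : cellMonomial K Q u * cellMonomial K Q v =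
      if weight 𝒬 Ψ (u + v) = weight 𝒬 Ψ u + weight 𝒬 Ψ v then cellMonomial K Q (u + v) else 0 := by
  have key := h.add_mem_iff hQ u v
  by_cases huv : u.1 ∈ monoidSQ P Q ∧ v.1 ∈ monoidSQ P Q
  · have h' := key.2 huv
    rw [if_pos h'.2, cellMonomial, cellMonomial, cellMonomial, dif_pos huv.1, dif_pos huv.2,
      dif_pos h'.1, single_mul_single, one_mul]
    rfl
  · have h1 : cellMonomial K Q u * cellMonomial K Q v = 0 := by
      by_cases hu : u.1 ∈ monoidSQ P Q
      · have hv : v.1 ∉ monoidSQ P Q := fun hv => huv ⟨hu, hv⟩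
        rw [cellMonomial, cellMonomial, dif_neg hv, mul_zero]
      · rw [cellMonomial, dif_neg hu, zero_mul]
    rw [h1]
    split_ifs with hw
    · rw [cellMonomial, dif_neg fun h' => huv (key.1 ⟨h', hw⟩)]
    · rfl

/-- The projection of the associated graded algebra to the semigroup algebra of a cell. -/
def grToCell (h : IsAdapted 𝒬 Ψ) {Q : MarkedPolytope d} (hQ : Q ∈ 𝒬.cells) :
    GrV K 𝒬 Ψ →ₐ[K] AddMonoidAlgebra K (monoidSQ P Q) :=
  AlgHom.ofLinearMap (grToCellLinear K 𝒬 Ψ Q)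
    (by
      rw [← grBasisFn_zero, grToCellLinear_grBasisFn, cellMonomial,
        dif_pos (show (0 : monoidS P).1 ∈ monoidSQ P Q from zero_mem _)]
      rfl)
    (by
      have hB : (LinearMap.mul K (GrV K 𝒬 Ψ)).compr₂ (grToCellLinear K 𝒬 Ψ Q) =
          (LinearMap.mul K (AddMonoidAlgebra K (monoidSQ P Q))).compl₁₂
            (grToCellLinear K 𝒬 Ψ Q) (grToCellLinear K 𝒬 Ψ Q) := by
        refine LinearMap.ext_on (span_grBasisFn K 𝒬 Ψ) ?_
        rintro _ ⟨u, rfl⟩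
        refine LinearMap.ext_on (span_grBasisFn K 𝒬 Ψ) ?_
        rintro _ ⟨v, rfl⟩
        simp only [LinearMap.compr₂_apply, LinearMap.compl₁₂_apply, LinearMap.mul_apply',
          grToCellLinear_grBasisFn, h.cellMonomial_mul K hQ, grBasisFn_mul]
        split_ifs
        · exact grToCellLinear_grBasisFn K 𝒬 Ψ Q _
        · exact map_zero _
      intro x y
      exact LinearMap.congr_fun₂ hB x y)

variable (h : IsAdapted 𝒬 Ψ) {Q : MarkedPolytope d} (hQ : Q ∈ 𝒬.cells)

theorem grToCell_grBasisFn (u : monoidS P) :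
    grToCell K h hQ (grBasisFn K 𝒬 Ψ u) = cellMonomial K Q u :=
  grToCellLinear_grBasisFn K 𝒬 Ψ Q u

theorem grToCell_surjective : Function.Surjective (grToCell K h hQ) := by
  intro F
  induction F using AddMonoidAlgebra.induction_linear with
  | zero => exact ⟨0, map_zero _⟩
  | add F G hF hG =>
    obtain ⟨x, rfl⟩ := hF
    obtain ⟨y, rfl⟩ := hG
    exact ⟨x + y, map_add _ _ _⟩
  | single u c =>
    refine ⟨c • grBasisFn K 𝒬 Ψ ⟨u.1, u.2.1⟩, ?_⟩
    rw [map_smul, grToCell_grBasisFn, cellMonomial, dif_pos u.2, smul_single, smul_eq_mul, mul_one]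

theorem grToCell_mem {i : ℕ} {x : GrV K 𝒬 Ψ} (hx : x ∈ grVDeg K 𝒬 Ψ i) :
    grToCell K h hQ x ∈ monoidGrade K (monoidSQ P Q) i := by
  rw [grVDeg_eq_span] at hx
  induction hx using Submodule.span_induction with
  | mem x hx =>
    obtain ⟨u, rfl, rfl⟩ := hx
    rw [grToCell_grBasisFn, cellMonomial]
    split_ifs with hu
    · exact single_mem_monoidGrade _ _
    · exact zero_mem _
  | zero => rw [map_zero]; exact zero_mem _
  | add x y _ _ hx hy => rw [map_add]; exact add_mem hx hy
  | smul c x _ hx => rw [map_smul]; exact Submodule.smul_mem _ _ hx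

/-- The projection to the semigroup algebra of a cell as a homomorphism of graded rings. -/
def gradedGrToCell : grVDeg K 𝒬 Ψ →+*ᵍ monoidGrade K (monoidSQ P Q) where
  toRingHom := (grToCell K h hQ).toRingHom
  map_mem := grToCell_mem K h hQ

/-- The projections to all cells. -/
def grToCells : GrV K 𝒬 Ψ →ₐ[K] ∀ Q : 𝒬.cells, AddMonoidAlgebra K (monoidSQ P Q.1) :=
  AlgHom.pi fun Q : 𝒬.cells => grToCell K h Q.2

/-- Every `u ∈ S` lies in some `S_Q`, so its coefficient in an element of the associated graded
algebra can be read off in `K[S_Q]`. -/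
theorem grToCells_injective : Function.Injective (grToCells K h) := by
  rw [injective_iff_map_eq_zero]
  intro x hx
  have hmem : x ∈ Submodule.span K (Set.range (grBasisFn K 𝒬 Ψ)) := by
    rw [span_grBasisFn]
    trivial
  obtain ⟨c, rfl⟩ := Finsupp.mem_span_range_iff_exists_finsupp.1 hmem
  have hc : ∀ u, c u = 0 := by
    intro u
    obtain ⟨Q, hQ, hu⟩ := exists_cell_of_monoidS 𝒬 u
    have h1 : grToCell K h hQ (c.sum fun u a => a • grBasisFn K 𝒬 Ψ u) = 0 := congrFun hx ⟨Q, hQ⟩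
    have h2 := congrArg (fun F => F.coeff ⟨u.1, hu⟩) h1
    simp only [Finsupp.sum, map_sum, map_smul, grToCell_grBasisFn, coeff_sum, coeff_smul,
      Finsupp.finsetSum_apply, Finsupp.smul_apply, smul_eq_mul, coeff_zero,
      Finsupp.zero_apply] at h2
    rw [Finset.sum_eq_single u] at h2
    · rwa [cellMonomial, dif_pos hu, coeff_single, Finsupp.single_eq_same, mul_one] at h2
    · intro v _ hv
      rw [cellMonomial]
      split_ifs with hv'
      · rw [coeff_single, Finsupp.single_eq_of_ne, mul_zero]
        exact fun h' => hv (Subtype.ext (congrArg Subtype.val h').symm)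
      · rw [coeff_zero, Finsupp.zero_apply, mul_zero]
    · intro hu'
      rw [Finsupp.notMem_support_iff.1 hu', zero_mul]
  have : c = 0 := Finsupp.ext hc
  rw [this, Finsupp.sum_zero_index]

/-- A subring of a product of domains is reduced. -/
theorem isReduced_grV (h : IsAdapted 𝒬 Ψ) : _root_.IsReduced (GrV K 𝒬 Ψ) :=
  isReduced_of_injective (grToCells K h) (grToCells_injective K h)

theorem range_grToCells : (grToCells K h).toLinearMap.range =
    Submodule.span K (Set.range fun u : monoidS P => fun Q : 𝒬.cells => cellMonomial K Q.1 u) := by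
  rw [LinearMap.range_eq_map, ← span_grBasisFn, Submodule.map_span, ← Set.range_comp]
  congr 2
  ext1 u
  funext Q
  exact grToCell_grBasisFn K h Q.2 u

theorem grBasisFn_add_of_mem (h : IsAdapted 𝒬 Ψ) {Q : MarkedPolytope d} (hQ : Q ∈ 𝒬.cells)
    {u v : monoidS P} (hu : u.1 ∈ monoidSQ P Q) (hv : v.1 ∈ monoidSQ P Q) :
    grBasisFn K 𝒬 Ψ (u + v) = grBasisFn K 𝒬 Ψ u * grBasisFn K 𝒬 Ψ v := by
  rw [grBasisFn_mul, if_pos ((h.add_mem_iff hQ u v).2 ⟨hu, hv⟩).2]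

/-- Generators of the monoids `S_Q` give generators of the associated graded algebra. -/
theorem finiteType_grV (h : IsAdapted 𝒬 Ψ) : Algebra.FiniteType K (GrV K 𝒬 Ψ) := by
  choose T hT hfin using fun Q : 𝒬.cells =>
    (AddSubmonoid.fg_iff _).1 (monoidSQ_fg (P := P) (𝒬.subset Q.1 Q.2))
  let X : Set (GrV K 𝒬 Ψ) := ⋃ Q : 𝒬.cells, grBasisFn K 𝒬 Ψ '' (Subtype.val ⁻¹' T Q)
  refine ⟨Subalgebra.fg_def.2 ⟨X, Set.finite_iUnion fun Q =>
    ((hfin Q).preimage Subtype.val_injective.injOn).image _, ?_⟩⟩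
  rw [← Algebra.toSubmodule_eq_top, eq_top_iff, ← span_grBasisFn, Submodule.span_le]
  rintro _ ⟨u, rfl⟩
  obtain ⟨Q, hQ, hu⟩ := exists_cell_of_monoidS 𝒬 u
  have key : ∀ w, w ∈ AddSubmonoid.closure (T ⟨Q, hQ⟩) → ∀ hw : w ∈ monoidS P,
      grBasisFn K 𝒬 Ψ ⟨w, hw⟩ ∈ Algebra.adjoin K X := by
    intro w hw
    induction hw using AddSubmonoid.closure_induction with
    | mem w hw' =>
      exact fun hw => Algebra.subset_adjoin (Set.mem_iUnion.2 ⟨⟨Q, hQ⟩, ⟨w, hw⟩, hw', rfl⟩)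
    | zero =>
      intro hw
      have : grBasisFn K 𝒬 Ψ ⟨0, hw⟩ = 1 := grBasisFn_zero K 𝒬 Ψ
      rw [this]
      exact one_mem _
    | add v w hv hw ihv ihw =>
      intro _
      rw [hT] at hv hw
      have := grBasisFn_add_of_mem K h hQ (u := ⟨v, hv.1⟩) (v := ⟨w, hw.1⟩) hv hw
      rw [AddMemClass.mk_add_mk] at this
      rw [this]
      exact mul_mem (ihv hv.1) (ihw hw.1)
  exact key u.1 (by rw [hT]; exact hu) u.2

/-- The image of the associated graded algebra in the product of the semigroup algebras of the cells
does not depend on the matrix. -/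
theorem exists_grV_algEquiv {Ψ Ψ' : Matrix (Fin N) P.A ℚ} (h : IsAdapted 𝒬 Ψ)
    (h' : IsAdapted 𝒬 Ψ') : ∃ e : GrV K 𝒬 Ψ ≃ₐ[K] GrV K 𝒬 Ψ',
      (∀ u, e (grBasisFn K 𝒬 Ψ u) = grBasisFn K 𝒬 Ψ' u) ∧
      ∀ i, (grVDeg K 𝒬 Ψ i).map e.toLinearMap = grVDeg K 𝒬 Ψ' i := by
  have hrange : (grToCells K h).range = (grToCells K h').range := by
    apply Subalgebra.toSubmodule_injective
    exact (range_grToCells K h).trans (range_grToCells K h').symm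
  let e := (AlgEquiv.ofInjective _ (grToCells_injective K h)).trans
    ((Subalgebra.equivOfEq _ _ hrange).trans
      (AlgEquiv.ofInjective _ (grToCells_injective K h')).symm)
  have he : ∀ u, e (grBasisFn K 𝒬 Ψ u) = grBasisFn K 𝒬 Ψ' u := by
    intro u
    change (AlgEquiv.ofInjective _ (grToCells_injective K h')).symm _ = _
    rw [AlgEquiv.symm_apply_eq]
    ext1
    change grToCells K h _ = grToCells K h' _
    funext Q
    exact (grToCell_grBasisFn K h Q.2 u).trans (grToCell_grBasisFn K h' Q.2 u).symm
  refine ⟨e, he, fun i => ?_⟩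
  rw [grVDeg_eq_span, grVDeg_eq_span, Submodule.map_span, Set.image_image]
  congr 1
  exact Set.image_congr fun u _ => he u

end AssociatedGraded

/-! ### The degenerate fiber -/

noncomputable section Degeneration

open AddMonoidAlgebra HomogeneousIdeal

variable (K : Type u) [Field K] {d N : ℕ} {P : MarkedPolytope d}

theorem topologicalKrullDim_projMonoidS :
    topologicalKrullDim (Proj (monoidGrade K (monoidS P))) = d := by
  obtain ⟨χ, hχ⟩ := P.nonempty
  have hmem : ∀ χ ∈ P.A, ((1, χ) : ℕ × (Fin d → ℤ)) ∈ monoidS P :=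
    fun χ hχ => AddSubmonoid.subset_closure ⟨χ, hχ, rfl⟩
  exact topologicalKrullDim_proj_monoidAlgebra K (monoidS_fg P) (fun _ => eq_zero_of_mem_monoidS)
    (hasFullRank_of_marking P hmem) ⟨_, hmem χ hχ, one_pos⟩

theorem topologicalKrullDim_projCoordRing [CharZero K] :
    topologicalKrullDim (Proj (coordGrade K P)) = d := by
  obtain ⟨Φ, -⟩ := exists_projIso (coordEquiv K P) (map_coordGrade K)
  rw [← topologicalKrullDim_projMonoidS K (P := P)]
  exact (Scheme.homeoOfIso Φ).isHomeomorph.topologicalKrullDim_eq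

theorem exists_monoidGrade_one_ne_zero {Q : MarkedPolytope d} (hQ : Q.A ⊆ P.A) :
    ∃ x ∈ monoidGrade K (monoidSQ P Q) 1, x ≠ 0 := by
  obtain ⟨χ, hχ⟩ := Q.nonempty
  exact ⟨_, single_mem_monoidGrade ⟨_, mem_monoidSQ hQ hχ⟩ 1, single_ne_zero.2 one_ne_zero⟩

theorem isIntegral_projCell {Q : MarkedPolytope d} (hQ : Q.A ⊆ P.A) :
    IsIntegral (Proj (monoidGrade K (monoidSQ P Q))) :=
  let ⟨_, hx, hx0⟩ := exists_monoidGrade_one_ne_zero K hQ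
  isIntegral_proj _ one_pos hx hx0

theorem topologicalKrullDim_projCell {Q : MarkedPolytope d} (hQ : Q.A ⊆ P.A) :
    topologicalKrullDim (Proj (monoidGrade K (monoidSQ P Q))) = d := by
  obtain ⟨χ, hχ⟩ := Q.nonempty
  exact topologicalKrullDim_proj_monoidAlgebra K (monoidSQ_fg hQ)
    (fun w hw => eq_zero_of_mem_monoidS hw.1)
    (hasFullRank_of_marking Q fun χ hχ => mem_monoidSQ hQ hχ) ⟨_, mem_monoidSQ hQ hχ, one_pos⟩

variable [CharZero K] {𝒬 : Subdivision P} {Ψ : Matrix (Fin N) P.A ℚ} (h : IsAdapted 𝒬 Ψ)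

/-- The inclusion of the toric variety of a cell in the degenerate fiber. -/
def cellInclusion (Q : 𝒬.cells) :
    Proj (monoidGrade K (monoidSQ P Q.1)) ⟶ Proj (grVDeg K 𝒬 Ψ) :=
  Proj.map (gradedGrToCell K h Q.2)
    (irrelevant_le_map_of_surjective _ (grToCell_surjective K h Q.2))

instance isClosedImmersion_cellInclusion (Q : 𝒬.cells) :
    IsClosedImmersion (cellInclusion K h Q) :=
  isClosedImmersion_projMap_of_surjective _ (grToCell_surjective K h Q.2)

theorem cellInclusion_projStr (Q : 𝒬.cells) :
    cellInclusion K h Q ≫ projStr K (grVDeg K 𝒬 Ψ) = projStr K (monoidGrade K (monoidSQ P Q.1)) :=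
  projMap_projStr _ (grToCell K h Q.2).commutes _

theorem mem_range_cellInclusion (Q : 𝒬.cells) (p : Proj (grVDeg K 𝒬 Ψ)) :
    p ∈ Set.range (cellInclusion K h Q) ↔
      RingHom.ker (grToCell K h Q.2) ≤ p.asHomogeneousIdeal.toIdeal := by
  have := range_projMap_of_surjective (gradedGrToCell K h Q.2) (grToCell_surjective K h Q.2)
  exact Set.ext_iff.1 this p

/-- The kernels of the projections to the cells intersect in zero. -/
theorem iUnion_range_cellInclusion : (⋃ Q, Set.range (cellInclusion K h Q)) = Set.univ := by
  refine Set.eq_univ_of_forall fun p => ?_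
  have hp := p.isPrime
  have hinf : (Finset.univ.inf fun Q : 𝒬.cells => RingHom.ker (grToCell K h Q.2)) ≤
      p.asHomogeneousIdeal.toIdeal := by
    intro x hx
    have : x = 0 := by
      apply grToCells_injective K h
      rw [map_zero]
      funext Q
      exact (Submodule.mem_finsetInf.1 hx Q (Finset.mem_univ Q) : _)
    rw [this]
    exact zero_mem _
  obtain ⟨Q, -, hQ⟩ := hp.inf_le'.1 hinf
  exact Set.mem_iUnion.2 ⟨Q, (mem_range_cellInclusion K h Q p).2 hQ⟩

/-- The generic point of `X_Q` lies in no other `X_{Q'}`: the class of `f_u` with `u` in the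
interior of `K(Q)` vanishes on them. -/
theorem not_range_cellInclusion_subset (Q : 𝒬.cells) :
    ¬ Set.range (cellInclusion K h Q) ⊆
      ⋃ Q' ∈ {Q' | Q' ≠ Q}, Set.range (cellInclusion K h Q') := by
  intro hsub
  obtain ⟨x, hx, hx0⟩ := exists_monoidGrade_one_ne_zero K (𝒬.subset Q.1 Q.2)
  have hη := hsub (Set.mem_range_self (projGenericPoint _ one_pos hx hx0))
  simp only [Set.mem_iUnion] at hη
  obtain ⟨Q', hne, hη⟩ := hη
  rw [mem_range_cellInclusion] at hη
  have hu := markingSum_mem (𝒬.subset Q.1 Q.2)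
  let u : monoidS P := ⟨markingSum Q.1, hu.1⟩
  have hker : grBasisFn K 𝒬 Ψ u ∈ RingHom.ker (grToCell K h Q'.2) := by
    rw [RingHom.mem_ker, grToCell_grBasisFn, cellMonomial,
      dif_neg fun hu' => hne (Subtype.ext (eq_of_markingSum_mem Q.2 Q'.2 hu').symm)]
  have h0 : grToCell K h Q.2 (grBasisFn K 𝒬 Ψ u) = 0 := hη hker
  rw [grToCell_grBasisFn, cellMonomial, dif_pos hu] at h0
  exact single_ne_zero.2 one_ne_zero h0

/-- The irreducible components are the images of the integral closed subschemes `X_Q`. -/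
theorem topologicalKrullDim_irreducibleComponent (h : IsAdapted 𝒬 Ψ)
    {Z : Set (Proj (grVDeg K 𝒬 Ψ))}
    (hZ : Z ∈ irreducibleComponents (Proj (grVDeg K 𝒬 Ψ))) : topologicalKrullDim Z = d := by
  obtain ⟨Q, hQ⟩ : ∃ Q, Z ⊆ Set.range (cellInclusion K h Q) := by
    have hirr := isIrreducible_iff_sUnion_isClosed.1 hZ.prop
      (Finset.univ.image fun Q : 𝒬.cells => Set.range (cellInclusion K h Q)) (by
        intro z hz
        obtain ⟨Q, -, rfl⟩ := Finset.mem_image.1 hz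
        exact (cellInclusion K h Q).isClosedEmbedding.isClosed_range) (by
        rw [Finset.coe_image, Finset.coe_univ, Set.image_univ, Set.sUnion_range,
          iUnion_range_cellInclusion]
        exact Set.subset_univ _)
    obtain ⟨z, hz, hZz⟩ := hirr
    obtain ⟨Q, -, rfl⟩ := Finset.mem_image.1 hz
    exact ⟨Q, hZz⟩
  have := isIntegral_projCell K (𝒬.subset Q.1 Q.2)
  have hirr : IsIrreducible (Set.range (cellInclusion K h Q)) := by
    have := (IrreducibleSpace.isIrreducible_univ _).image (cellInclusion K h Q)
      (cellInclusion K h Q).continuous.continuousOn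
    rwa [Set.image_univ] at this
  obtain rfl : Z = Set.range (cellInclusion K h Q) :=
    Set.Subset.antisymm hQ (hZ.le_of_ge hirr hQ)
  rw [← topologicalKrullDim_projCell K (𝒬.subset Q.1 Q.2)]
  let e := (cellInclusion K h Q).isClosedEmbedding.toHomeomorph
  exact e.symm.isHomeomorph.topologicalKrullDim_eq

end Degeneration

end GKZ

theorem mainTheorem10 {K : Type*} [Field K] [IsAlgClosed K] [CharZero K] {d N : ℕ} (hN : 1 ≤ N)
    (P : MarkedPolytope d) (𝒬 : Subdivision P) :
    (∀ Ψ : Matrix (Fin N) P.A ℚ, Ψ.map (Rat.cast : ℚ → ℝ) ∈ openGKZCone 𝒬 N →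
      -- the associated graded algebra is finitely generated and reduced, and so is its `Proj`
      Algebra.FiniteType K (GrV K 𝒬 Ψ) ∧
      _root_.IsReduced (GrV K 𝒬 Ψ) ∧
      AlgebraicGeometry.IsReduced (Proj (grVDeg K 𝒬 Ψ)) ∧
      -- each `Proj K[S_Q]` is the integral `Proj` of an affine semigroup algebra
      (∀ Q ∈ 𝒬.cells, (monoidSQ P Q).FG ∧ IsIntegral (Proj (monoidGrade K (monoidSQ P Q))) ∧
        topologicalKrullDim (Proj (monoidGrade K (monoidSQ P Q))) =
          topologicalKrullDim (Proj (coordGrade K P))) ∧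
      -- `Proj` is the irredundant union of closed subschemes `Proj K[S_Q]`
      (∃ ι : ∀ Q : 𝒬.cells, Proj (monoidGrade K (monoidSQ P Q.1)) ⟶ Proj (grVDeg K 𝒬 Ψ),
        (∀ Q, IsClosedImmersion (ι Q) ∧
          ι Q ≫ projStr K (grVDeg K 𝒬 Ψ) = projStr K (monoidGrade K (monoidSQ P Q.1))) ∧
        (⋃ Q, Set.range (ι Q)) = Set.univ ∧
        ∀ Q, ¬ Set.range (ι Q) ⊆ ⋃ Q' ∈ {Q' | Q' ≠ Q}, Set.range (ι Q')) ∧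
      -- it is equidimensional of dimension `dim X_A`
      ∀ Z ∈ irreducibleComponents (Proj (grVDeg K 𝒬 Ψ)),
        topologicalKrullDim Z = topologicalKrullDim (Proj (coordGrade K P))) ∧
    -- it depends only on `𝒬`
    (∀ Ψ Ψ' : Matrix (Fin N) P.A ℚ, Ψ.map (Rat.cast : ℚ → ℝ) ∈ openGKZCone 𝒬 N →
      Ψ'.map (Rat.cast : ℚ → ℝ) ∈ openGKZCone 𝒬 N →
      (∃ e : GrV K 𝒬 Ψ ≃ₐ[K] GrV K 𝒬 Ψ',
        (∀ u, e (grBasisFn K 𝒬 Ψ u) = grBasisFn K 𝒬 Ψ' u) ∧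
        ∀ i, (grVDeg K 𝒬 Ψ i).map e.toLinearMap = grVDeg K 𝒬 Ψ' i) ∧
      ∃ Φ : Proj (grVDeg K 𝒬 Ψ) ≅ Proj (grVDeg K 𝒬 Ψ'),
        Φ.hom ≫ projStr K (grVDeg K 𝒬 Ψ') = projStr K (grVDeg K 𝒬 Ψ)) := by
  refine ⟨fun Ψ hΨ => ?_, fun Ψ Ψ' hΨ hΨ' => ?_⟩
  · have h := isAdapted_of_mem_openGKZCone hΨ
    have hred := isReduced_grV K h
    rw [topologicalKrullDim_projCoordRing]
    exact ⟨finiteType_grV K h, hred, isReduced_proj _,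
      fun Q hQ => ⟨monoidSQ_fg (𝒬.subset Q hQ), isIntegral_projCell K (𝒬.subset Q hQ),
        topologicalKrullDim_projCell K (𝒬.subset Q hQ)⟩,
      ⟨cellInclusion K h, fun Q => ⟨inferInstance, cellInclusion_projStr K h Q⟩,
        iUnion_range_cellInclusion K h, not_range_cellInclusion_subset K h⟩,
      fun Z hZ => topologicalKrullDim_irreducibleComponent K h hZ⟩
  · obtain ⟨e, he, hdeg⟩ := exists_grV_algEquiv K (isAdapted_of_mem_openGKZCone hΨ)
      (isAdapted_of_mem_openGKZCone hΨ')
    exact ⟨⟨e, he, hdeg⟩, exists_projIso e hdeg⟩
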